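/- **Annealed region of the multiscale Sherrington–Kirkpatrick model.** Let $r\ge 1$, let $0<\zeta_0<\zeta_1<\dots<\zeta_r=1$ and $0=\gamma_0<\gamma_1<\dots<\gamma_r<\infty$, and let $P_h$ be a compactly supported probability measure on $\mathbb R$. For $N\ge1$ let $g^{(\ell)}_{ij}$ ($1\le \ell\le r$, $1\le i,j\le N$) be i.i.d. standard Gaussians and let $h_1,\dots,h_N$ be i.i.d. with law $P_h$, independent of the $g^{(\ell)}_{ij}$. For $\sigma\in\{-1,1\}^N$ put $$H_N(\sigma)=\sum_{\ell=1}^r\sqrt{\gamma_\ell^2-\gamma_{\ell-1}^2}\,\sum_{i,j=1}^N\frac{g^{(\ell)}_{ij}}{\sqrt N}\,\sigma_i\sigma_j ,\qquad Z_{r,N}=\sum_{\sigma\in\{-1,1\}^N}e^{-H_N(\sigma)-\sum_{i=1}^N h_i\sigma_i},$$ and define recursively, for $\ell=r,r-1,\dots,1$, $$Z_{\ell-1,N}^{\zeta_{\ell-1}}=\mathbb E_{g^{(\ell)}}\,Z_{\ell,N}^{\zeta_{\ell-1}},$$ where $\mathbb E_{g^{(\ell)}}$ is the expectation over $(g^{(\ell)}_{ij})_{i,j\le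 N}$ only. Let $p_N=\frac1N\,\mathbb E_h\log Z_{0,N}$ be the pressure per particle. Write "$h=0$ a.s." for $P_h(\{0\})=1$. Then: 1. If $h=0$ a.s. or $\gamma_r^2\le\frac12$, then $$\lim_{N\to\infty}p_N=\log 2+\frac{\gamma_r^2}{2}\quad\Longleftrightarrow\quad \gamma_r^2\le\tfrac12\ \text{ and }\ h=0\ \text{a.s.}$$ In particular, in the absence of an external field, the limiting pressure equals the annealed value $\log 2+\gamma_r^2/2$ if and only if $\gamma_r^2\le\frac12$. 2. For every compactly supported $P_h$, the limiting pressure equals the annealed value (all couplings averaged at the time scale of the spins, that is, the value $\frac1N\mathbb E_h\log\mathbb E_g Z_{r,N}$) in the presence of the field if and only if $\gamma_r^2\le\frac12$ and $h=0$ a.s.: $$\lim_{N\to\infty}p_N=\log 2+\int\log\cosh x\,P_h(dx)+\frac{\gamma_r^2}{2}\quad\Longleftrightarrow\quad \gamma_r^2\le\tfrac12\ \text{ and }\ h=0\ \text{a.s.}$$ -/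

import Mathlib

open MeasureTheory ProbabilityTheory Filter Topology

namespace MultiscaleSK

/-- A spin configuration in `{-1, 1}^N`. -/
abbrev Config (N : ℕ) : Type := Fin N → ℤˣ

/-- The spin `σ i = ±1` as a real number. -/
def spin {N : ℕ} (σ : Config N) (i : Fin N) : ℝ := ((σ i : ℤ) : ℝ)

/-- One family of couplings `(g i j)` with `i, j ≤ N`, indexed by the pairs `(i, j)`. -/
abbrev Couplings (N : ℕ) : Type := Fin N × Fin N → ℝ

/-- The law of one family of independent standard Gaussian couplings. -/
noncomputable def couplingLaw (N : ℕ) : Measure (Couplings N) :=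
  Measure.pi fun _ => gaussianReal 0 1

section Model

variable {r : ℕ} (ζ γ : Fin (r + 1) → ℝ) {N : ℕ}

/-- The Hamiltonian of a single time scale. The index `i : Fin r` stands for the scale
`ℓ = i + 1`, so that `γ i.succ` and `γ i.castSucc` are the parameters at `ℓ` and `ℓ - 1`. -/
noncomputable def levelHamiltonian (i : Fin r) (g : Couplings N) (σ : Config N) : ℝ :=
  Real.sqrt (γ i.succ ^ 2 - γ i.castSucc ^ 2) *
    ∑ a : Fin N, ∑ b : Fin N, g (a, b) / Real.sqrt N * spin σ a * spin σ b

/-- The Hamiltonian, the sum of the Hamiltonians of the `r` scales. -/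
noncomputable def hamiltonian (g : Fin r → Couplings N) (σ : Config N) : ℝ :=
  ∑ i : Fin r, levelHamiltonian γ i (g i) σ

/-- The partition function, given all the couplings and the external fields `h`. -/
noncomputable def partitionFunction (h : Fin N → ℝ) (g : Fin r → Couplings N) : ℝ :=
  ∑ σ : Config N, Real.exp (-hamiltonian γ g σ - ∑ a : Fin N, h a * spin σ a)

/-- The random variables `Z_ℓ`, `0 ≤ ℓ ≤ r`; `Z_ℓ` is a function of the couplings of the first `ℓ`
scales. The recursion runs downwards: `Z_r` is the partition function, and
`Z_ℓ ^ ζ_ℓ` is the expectation of `Z_{ℓ+1} ^ ζ_ℓ` over the couplings of the scale `ℓ + 1`. -/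
noncomputable def multiscaleZ (h : Fin N → ℝ) (ℓ : Fin (r + 1)) : (Fin ℓ → Couplings N) → ℝ :=
  Fin.reverseInduction (motive := fun ℓ : Fin (r + 1) => (Fin ℓ → Couplings N) → ℝ)
    (fun g => partitionFunction γ h g)
    (fun i Z g =>
      (∫ x, Z (Fin.snoc (α := fun _ => Couplings N) g x) ^ ζ i.castSucc ∂couplingLaw N)
        ^ (1 / ζ i.castSucc))
    ℓ

theorem multiscaleZ_last (h : Fin N → ℝ) (g : Fin r → Couplings N) :
    multiscaleZ ζ γ h (Fin.last r) g = partitionFunction γ h g := by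
  unfold multiscaleZ
  rw [Fin.reverseInduction_last]

theorem multiscaleZ_castSucc (h : Fin N → ℝ) (i : Fin r) (g : Fin i → Couplings N) :
    multiscaleZ ζ γ h i.castSucc g =
      (∫ x, multiscaleZ ζ γ h i.succ (Fin.snoc (α := fun _ => Couplings N) g x)
        ^ ζ i.castSucc ∂couplingLaw N) ^ (1 / ζ i.castSucc) := by
  unfold multiscaleZ
  rw [Fin.reverseInduction_castSucc]

/-- The pressure per particle of the system of size `N`, where the external fields at the `N` sites
are independent with law `Ph`. -/
noncomputable def pressure (Ph : Measure ℝ) (N : ℕ) : ℝ :=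
  1 / (N : ℝ) *
    ∫ h : Fin N → ℝ, Real.log (multiscaleZ ζ γ h 0 (fun i => i.elim0)) ∂Measure.pi (fun _ => Ph)

end Model

end MultiscaleSK

/-! The scales can be removed at once. Each step of the recursion is an average in some norm `L^ζ`
with `ζ 0 ≤ ζ ≤ ζ_{r-1} < 1`; the last exponent `ζ_r = 1` never enters it. Jensen's inequality
compares each such norm with those of orders `a = ζ 0` and `b = ζ_{r-1}`, and independent Gaussian
scales merge into one of variance `c ^ 2`, where `c = γ_r`. Hence `log Z_0` lies between `(1/a) log
E Z ^ a` and `(1/b) log E Z ^ b`, with `Z` the partition function of an ordinary one-scale model at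
inverse temperature `c` (`IsBetweenMoments.average`, `exists_hasMomentBounds`). What remains is to
estimate fractional moments, with exponents fixed as `N` grows. Four estimates suffice.

Annealed upper bound, always: `E Z ^ b ≤ (E Z) ^ b`.

Lower bound for `c ^ 2 ≤ 1/2` and a weak field: `E Z ^ 2` is at most a polynomial factor times `(E
Z) ^ 2`, up to a small field term, and this forces `E Z ^ a` to be close to `(E Z) ^ a`
(`integral_expSum_sq_le`, `le_log_moment`). A general field is first scaled down to a weak one,
which only lowers the moment. If the field is not zero, the gain from `log cosh` exceeds the loss,
so the pressure stays strictly above `log 2 + c ^ 2 / 2`.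

Strict upper bound in a nonzero field: replicas have positive overlap under the annealed weights, so
a small Gaussian tilt along `tanh h ⊗ tanh h` lowers the tilted mean to first order and costs only
second order, thanks to `b < 1` (`integral_expSum_rpow_le_tilt`, `log_moment_le`).

Strict upper bound in zero field for `c ^ 2 > 1/2`: a Guerra interpolation bounds `E Z ^ b` by a
replica symmetric expression with overlap parameter `q` (`integral_expSum_rpow_comparison`,
`moment_zero_le`). Its expansion at `q = 0` agrees with the annealed value to first order, and the
second-order coefficient changes sign exactly at `c ^ 2 = 1/2` (`exists_integral_cosh_rpow_lt`). -/

namespace MultiscaleSK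

/-- The law of a family of independent standard Gaussian variables indexed by `ι`. -/
noncomputable abbrev stdGaussian (ι : Type*) [Fintype ι] : Measure (ι → ℝ) :=
  Measure.pi fun _ => gaussianReal 0 1

/-! ### Gaussian families: exponential integrability, sums, integration by parts -/

section Gaussian

variable {ι : Type*} [Fintype ι]

theorem integrable_exp_mul_abs_gaussianReal (c : ℝ) :
    Integrable (fun y : ℝ => Real.exp (c * |y|)) (gaussianReal 0 1) := by
  refine ((integrable_exp_mul_gaussianReal (μ := 0) (v := 1) c).add
    (integrable_exp_mul_gaussianReal (μ := 0) (v := 1) (-c))).mono'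
      (by fun_prop) (ae_of_all _ fun y => ?_)
  rw [Real.norm_eq_abs, Real.abs_exp]
  rcases abs_cases y with ⟨h, _⟩ | ⟨h, _⟩
  · rw [h]; exact le_add_of_nonneg_right (Real.exp_pos _).le
  · rw [h, mul_neg, ← neg_mul]; exact le_add_of_nonneg_left (Real.exp_pos _).le

theorem integrable_exp_mul_sum_abs (c : ℝ) :
    Integrable (fun x : ι → ℝ => Real.exp (c * ∑ k, |x k|)) (stdGaussian ι) := by
  simp_rw [Finset.mul_sum, Real.exp_sum]
  exact Integrable.fintype_prod (f := fun (_ : ι) (y : ℝ) => Real.exp (c * |y|))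
    fun _ => integrable_exp_mul_abs_gaussianReal c

theorem integrable_of_abs_le_exp {f : (ι → ℝ) → ℝ} (hf : AEStronglyMeasurable f (stdGaussian ι))
    {K c : ℝ} (hb : ∀ x, |f x| ≤ K * Real.exp (c * ∑ k, |x k|)) :
    Integrable f (stdGaussian ι) :=
  ((integrable_exp_mul_sum_abs c).const_mul K).mono' hf (ae_of_all _ hb)

theorem abs_sum_mul_le {a : ι → ℝ} {M : ℝ} (ha : ∀ k, |a k| ≤ M) (x : ι → ℝ) :
    |∑ k, a k * x k| ≤ M * ∑ k, |x k| := by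
  rw [Finset.mul_sum]
  refine (Finset.abs_sum_le_sum_abs _ _).trans (Finset.sum_le_sum fun k _ => ?_)
  rw [abs_mul]
  exact mul_le_mul_of_nonneg_right (ha k) (abs_nonneg _)

theorem integrable_exp_sum_mul (a : ι → ℝ) :
    Integrable (fun x : ι → ℝ => Real.exp (∑ k, a k * x k)) (stdGaussian ι) := by
  simp_rw [Real.exp_sum]
  exact Integrable.fintype_prod (f := fun k (y : ℝ) => Real.exp (a k * y))
    fun _ => integrable_exp_mul_gaussianReal _

theorem integral_exp_mul_gaussianReal (t : ℝ) :
    ∫ y, Real.exp (t * y) ∂gaussianReal 0 1 = Real.exp (t ^ 2 / 2) := by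
  have := congrFun (mgf_fun_id_gaussianReal (μ := 0) (v := 1)) t
  simpa [mgf] using this

theorem integral_exp_sum_mul (a : ι → ℝ) :
    ∫ x : ι → ℝ, Real.exp (∑ k, a k * x k) ∂stdGaussian ι
      = Real.exp ((∑ k, a k ^ 2) / 2) := by
  simp_rw [Real.exp_sum]
  rw [integral_fintype_prod_eq_prod (fun k (y : ℝ) => Real.exp (a k * y))]
  simp_rw [integral_exp_mul_gaussianReal]
  rw [← Real.exp_sum, Finset.sum_div]

theorem measurePreserving_smul_add_smul (c d : ℝ) :
    MeasurePreserving (fun p : ℝ × ℝ => c * p.1 + d * p.2)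
      ((gaussianReal 0 1).prod (gaussianReal 0 1))
      ((gaussianReal 0 1).map fun y => √(c ^ 2 + d ^ 2) * y) := by
  refine ⟨by fun_prop, ?_⟩
  have h1 : (fun p : ℝ × ℝ => c * p.1 + d * p.2)
      = (fun q : ℝ × ℝ => q.1 + q.2) ∘ Prod.map (fun y => c * y) (fun y => d * y) := rfl
  rw [h1, ← Measure.map_map (by fun_prop) (by fun_prop),
    ← Measure.map_prod_map _ _ (by fun_prop) (by fun_prop), gaussianReal_map_const_mul,
    gaussianReal_map_const_mul, gaussianReal_map_const_mul]
  have := gaussianReal_conv_gaussianReal (m₁ := 0) (m₂ := 0)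
    (v₁ := NNReal.mk (c ^ 2) (sq_nonneg c)) (v₂ := NNReal.mk (d ^ 2) (sq_nonneg d))
  rw [Measure.conv] at this
  simp only [mul_zero, mul_one, add_zero] at this ⊢
  rw [this]
  congr 1
  ext
  simp [Real.sq_sqrt (add_nonneg (sq_nonneg c) (sq_nonneg d))]

/-- The sum of two independent centred Gaussian families is Gaussian with added variances. The
exponential growth bound justifies Fubini. This is what merges two time scales into one. -/
theorem integral_integral_add_stdGaussian (c d : ℝ) {f : (ι → ℝ) → ℝ} (hf : Continuous f)
    {K M : ℝ} (hb : ∀ x, |f x| ≤ K * Real.exp (M * ∑ k, |x k|)) :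
    ∫ x, ∫ y, f (fun k => c * x k + d * y k) ∂stdGaussian ι ∂stdGaussian ι
      = ∫ x, f (fun k => √(c ^ 2 + d ^ 2) * x k) ∂stdGaussian ι := by
  have hmp : MeasurePreserving
      (fun p : (ι → ℝ) × (ι → ℝ) => fun k => c * p.1 k + d * p.2 k)
      ((stdGaussian ι).prod (stdGaussian ι))
      ((stdGaussian ι).map fun x k => √(c ^ 2 + d ^ 2) * x k) := by
    have e := measurePreserving_arrowProdEquivProdArrow ℝ ℝ ι
      (fun _ => gaussianReal 0 1) (fun _ => gaussianReal 0 1)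
    have hpi := measurePreserving_pi
      (fun _ : ι => (gaussianReal 0 1).prod (gaussianReal 0 1))
      (fun _ : ι => (gaussianReal 0 1).map fun y => √(c ^ 2 + d ^ 2) * y)
      (fun _ => measurePreserving_smul_add_smul c d)
    have hpi' := measurePreserving_pi (fun _ : ι => gaussianReal 0 1)
      (fun _ : ι => (gaussianReal 0 1).map fun y => √(c ^ 2 + d ^ 2) * y)
      (fun _ => ⟨by fun_prop, rfl⟩)
    rw [hpi'.map_eq]
    exact hpi.comp e.symm
  have habs : ∀ x : ι → ℝ, ∑ k, |√(c ^ 2 + d ^ 2) * x k| = √(c ^ 2 + d ^ 2) * ∑ k, |x k| := by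
    intro x
    simp_rw [abs_mul, abs_of_nonneg (Real.sqrt_nonneg (c ^ 2 + d ^ 2)), Finset.mul_sum]
  have hint : Integrable f ((stdGaussian ι).map fun x k => √(c ^ 2 + d ^ 2) * x k) := by
    rw [integrable_map_measure hf.aestronglyMeasurable
      (Measurable.aemeasurable (by fun_prop))]
    refine integrable_of_abs_le_exp (K := K) (c := M * √(c ^ 2 + d ^ 2))
      (hf.comp (by fun_prop)).aestronglyMeasurable fun x => ?_
    have := hb (fun k => √(c ^ 2 + d ^ 2) * x k)
    rw [habs, ← mul_assoc] at this
    exact this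
  have hint2 : Integrable (fun p : (ι → ℝ) × (ι → ℝ) => f (fun k => c * p.1 k + d * p.2 k))
      ((stdGaussian ι).prod (stdGaussian ι)) :=
    (hmp.integrable_comp hf.aestronglyMeasurable).2 hint
  rw [← integral_prod _ hint2]
  rw [← hmp.map_eq] at hint
  have h1 := integral_map (μ := (stdGaussian ι).prod (stdGaussian ι)) hmp.measurable.aemeasurable
    (f := f) hf.aestronglyMeasurable
  rw [← h1, hmp.map_eq, 
    integral_map (Measurable.aemeasurable (by fun_prop)) hf.aestronglyMeasurable]

/-- Resampling one coordinate preserves the product law, which reduces integration by parts in many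
variables to one variable. -/
theorem measurePreserving_update [DecidableEq ι] (k : ι) :
    MeasurePreserving (fun p : (ι → ℝ) × ℝ => Function.update p.1 k p.2)
      ((stdGaussian ι).prod (gaussianReal 0 1)) (stdGaussian ι) := by
  have hm : Measurable (fun p : (ι → ℝ) × ℝ => Function.update p.1 k p.2) := by
    refine measurable_pi_lambda _ fun j => ?_
    by_cases h : j = k
    · subst h; simpa using measurable_snd
    · simp only [Function.update_of_ne h]; fun_prop
  refine ⟨hm, ?_⟩
  symm
  refine Measure.pi_eq fun s hs => ?_
  rw [Measure.map_apply hm (MeasurableSet.univ_pi hs)]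
  have : (fun p : (ι → ℝ) × ℝ => Function.update p.1 k p.2) ⁻¹' (Set.univ.pi s)
      = (Set.univ.pi (Function.update s k Set.univ)) ×ˢ s k := by
    ext p
    simp only [Set.mem_preimage, Set.mem_pi, Set.mem_univ, true_implies, Set.mem_prod]
    constructor
    · intro h
      refine ⟨fun j => ?_, by simpa using h k⟩
      by_cases hj : j = k
      · subst hj; simp
      · simpa [hj] using h j
    · rintro ⟨h1, h2⟩ j
      by_cases hj : j = k
      · subst hj; simpa using h2
      · simpa [hj] using h1 j
  rw [this, Measure.prod_prod, Measure.pi_pi, mul_comm,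
    ← Finset.mul_prod_erase Finset.univ (fun j => (gaussianReal 0 1) (s j)) (Finset.mem_univ k)]
  congr 1
  rw [← Finset.mul_prod_erase Finset.univ _ (Finset.mem_univ k)]
  simp only [Function.update_self, measure_univ, one_mul]
  refine Finset.prod_congr rfl fun j hj => ?_
  rw [Function.update_of_ne (Finset.ne_of_mem_erase hj)]

theorem hasDerivAt_gaussianPDFReal (y : ℝ) :
    HasDerivAt (gaussianPDFReal 0 1) (-y * gaussianPDFReal 0 1 y) y := by
  have h : HasDerivAt (fun y : ℝ => -(y - 0) ^ 2 / (2 * ((1 : NNReal) : ℝ))) (-y) y := by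
    have := (((hasDerivAt_id y).sub_const 0).pow 2).neg.div_const (2 * ((1 : NNReal) : ℝ))
    convert! this using 1
    simp
    ring
  have := (h.exp).const_mul (√(2 * Real.pi * ((1 : NNReal) : ℝ)))⁻¹
  rw [gaussianPDFReal_def]
  convert! this using 1
  ring

/-- The density `p` satisfies `p' = -y p`, so this is integration by parts on the line. -/
theorem integral_mul_gaussianReal {f f' : ℝ → ℝ} (hf : ∀ y, HasDerivAt f (f' y) y)
    (h0 : Integrable f (gaussianReal 0 1)) (h1 : Integrable f' (gaussianReal 0 1))
    (h2 : Integrable (fun y => y * f y) (gaussianReal 0 1)) :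
    ∫ y, y * f y ∂gaussianReal 0 1 = ∫ y, f' y ∂gaussianReal 0 1 := by
  have key : ∀ g : ℝ → ℝ, Integrable g (gaussianReal 0 1) →
      Integrable (fun y => gaussianPDFReal 0 1 y * g y) := by
    intro g hg
    rw [gaussianReal_of_var_ne_zero 0 one_ne_zero] at hg
    rw [integrable_withDensity_iff_integrable_smul' (measurable_gaussianPDF 0 1)
      (ae_of_all _ fun _ => gaussianPDF_lt_top)] at hg
    simpa [toReal_gaussianPDF, smul_eq_mul] using hg
  rw [integral_gaussianReal_eq_integral_smul one_ne_zero,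
    integral_gaussianReal_eq_integral_smul one_ne_zero]
  have := integral_mul_deriv_eq_deriv_mul_of_integrable (u := gaussianPDFReal 0 1) (v := f)
    (u' := fun y => -y * gaussianPDFReal 0 1 y) (v' := f')
    (fun y _ => hasDerivAt_gaussianPDFReal y) (fun y _ => hf y) (key _ h1)
    ((key _ h2).neg.congr (ae_of_all _ fun y => by simp; ring)) (key _ h0)
  simp only [smul_eq_mul]
  rw [this, ← integral_neg]
  refine integral_congr_ae (ae_of_all _ fun y => ?_)
  simp only
  ring

/-- Gaussian integration by parts for functions of exponential growth. -/
theorem integral_mul_stdGaussian [DecidableEq ι] (k : ι) {F F' : (ι → ℝ) → ℝ}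
    (hF : ∀ x y, HasDerivAt (fun y => F (Function.update x k y)) (F' (Function.update x k y)) y)
    (hc : Continuous F) (hc' : Continuous F') {K M : ℝ} (hM : 0 ≤ M)
    (hb : ∀ x, |F x| ≤ K * Real.exp (M * ∑ j, |x j|))
    (hb' : ∀ x, |F' x| ≤ K * Real.exp (M * ∑ j, |x j|)) :
    ∫ x, x k * F x ∂stdGaussian ι = ∫ x, F' x ∂stdGaussian ι := by
  have hK : 0 ≤ K := by
    have := (abs_nonneg _).trans (hb 0)
    simpa using this
  -- The extra factor `x k` is absorbed by raising the exponential rate from `M` to `M + 1`.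
  have hkF : ∀ x : ι → ℝ, |x k * F x| ≤ K * Real.exp ((M + 1) * ∑ j, |x j|) := by
    intro x
    have h1 : |x k| ≤ Real.exp (∑ j, |x j|) := by
      have h2 : |x k| ≤ ∑ j, |x j| :=
        Finset.single_le_sum (f := fun j => |x j|) (fun _ _ => abs_nonneg _) (Finset.mem_univ k)
      linarith [Real.add_one_le_exp (∑ j, |x j|)]
    rw [abs_mul, add_mul, one_mul, Real.exp_add, mul_comm, ← mul_assoc]
    exact mul_le_mul (hb x) h1 (abs_nonneg _) (by positivity)
  have hsum : ∀ (x : ι → ℝ) (y : ℝ), ∑ j, |Function.update x k y j| ≤ ∑ j, |x j| + |y| := by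
    intro x y
    rw [← Finset.add_sum_erase Finset.univ _ (Finset.mem_univ k), Function.update_self, add_comm]
    refine add_le_add ?_ le_rfl
    calc ∑ j ∈ Finset.univ.erase k, |Function.update x k y j|
        = ∑ j ∈ Finset.univ.erase k, |x j| := Finset.sum_congr rfl fun j hj => by
          rw [Function.update_of_ne (Finset.ne_of_mem_erase hj)]
      _ ≤ ∑ j, |x j| := Finset.sum_le_sum_of_subset_of_nonneg (Finset.erase_subset _ _)
          fun _ _ _ => abs_nonneg _
  have hcu : ∀ x : ι → ℝ, Continuous (fun y => Function.update x k y) := fun x =>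
    continuous_const.update k continuous_id
  have slice : ∀ (G : (ι → ℝ) → ℝ) (L : ℝ), Continuous G → 0 ≤ L →
      (∀ x, |G x| ≤ K * Real.exp (L * ∑ j, |x j|)) → ∀ x,
      Integrable (fun y => G (Function.update x k y)) (gaussianReal 0 1) := by
    intro G L hG hL hGb x
    refine ((integrable_exp_mul_abs_gaussianReal L).const_mul
      (K * Real.exp (L * ∑ j, |x j|))).mono' (hG.comp (hcu x)).aestronglyMeasurable
        (ae_of_all _ fun y => (hGb _).trans ?_)
    rw [mul_assoc, ← Real.exp_add, ← mul_add]
    gcongr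
    exact hsum x y
  have resample : ∀ G : (ι → ℝ) → ℝ, Integrable G (stdGaussian ι) →
      ∫ x, G x ∂stdGaussian ι
        = ∫ x, ∫ y, G (Function.update x k y) ∂gaussianReal 0 1 ∂stdGaussian ι := by
    intro G hG
    have hmp := measurePreserving_update k
    have h2 : Integrable (fun p : (ι → ℝ) × ℝ => G (Function.update p.1 k p.2))
        ((stdGaussian ι).prod (gaussianReal 0 1)) :=
      (hmp.integrable_comp hG.aestronglyMeasurable).2 hG
    rw [← integral_prod _ h2]
    have hG' := hG.aestronglyMeasurable
    conv_lhs => rw [← hmp.map_eq]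
    rw [← hmp.map_eq] at hG'
    rw [integral_map hmp.measurable.aemeasurable hG']
  rw [resample _ (integrable_of_abs_le_exp (by fun_prop) hkF),
    resample _ (integrable_of_abs_le_exp hc'.aestronglyMeasurable hb')]
  refine integral_congr_ae (ae_of_all _ fun x => ?_)
  have h3 := slice (fun x => x k * F x) (M + 1) (by fun_prop) (by linarith) hkF x
  simp only [Function.update_self] at h3 ⊢
  exact integral_mul_gaussianReal (hF x) (slice F M hc hM hb x) (slice F' M hc' hM hb' x) h3

end Gaussian

/-! ### Fractional moments of Gaussian partition functions and their comparison -/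

section ExpSum

variable {S ι : Type*} [Fintype S] [Fintype ι]

/-- A partition function whose energies are `u σ` plus a linear form in the variables `x`. -/
noncomputable def expSum (u : S → ℝ) (α : S → ι → ℝ) (x : ι → ℝ) : ℝ :=
  ∑ σ, Real.exp (u σ + ∑ k, α σ k * x k)

theorem expSum_pos [Nonempty S] (u : S → ℝ) (α : S → ι → ℝ) (x : ι → ℝ) : 0 < expSum u α x :=
  Finset.sum_pos (fun _ _ => Real.exp_pos _) Finset.univ_nonempty

theorem exp_le_expSum (u : S → ℝ) (α : S → ι → ℝ) (x : ι → ℝ) (σ : S) :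
    Real.exp (u σ + ∑ k, α σ k * x k) ≤ expSum u α x :=
  Finset.single_le_sum (f := fun σ => Real.exp (u σ + ∑ k, α σ k * x k))
    (fun _ _ => (Real.exp_pos _).le) (Finset.mem_univ σ)

@[fun_prop]
theorem continuous_expSum (u : S → ℝ) (α : S → ι → ℝ) : Continuous (expSum u α) := by
  unfold expSum; fun_prop

theorem expSum_le [Nonempty S] (u : S → ℝ) {α : S → ι → ℝ} {M : ℝ} (hα : ∀ σ k, |α σ k| ≤ M)
    (x : ι → ℝ) : expSum u α x ≤ (∑ σ, Real.exp (u σ)) * Real.exp (M * ∑ k, |x k|) := by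
  rw [expSum, Finset.sum_mul]
  refine Finset.sum_le_sum fun σ _ => ?_
  rw [← Real.exp_add]
  have := (abs_le.1 (abs_sum_mul_le (hα σ) x)).2
  gcongr

theorem continuous_expSum_rpow [Nonempty S] (u : S → ℝ) (α : S → ι → ℝ) (p : ℝ) :
    Continuous fun x => expSum u α x ^ p :=
  (continuous_expSum u α).rpow_const fun x => Or.inl (expSum_pos u α x).ne'

theorem expSum_rpow_le [Nonempty S] (u : S → ℝ) {α : S → ι → ℝ} {M : ℝ}
    (hα : ∀ σ k, |α σ k| ≤ M) {m : ℝ} (hm : 0 ≤ m) (x : ι → ℝ) :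
    expSum u α x ^ m ≤ (∑ σ, Real.exp (u σ)) ^ m * Real.exp (m * M * ∑ k, |x k|) := by
  have h0 : 0 ≤ ∑ σ, Real.exp (u σ) := Finset.sum_nonneg fun _ _ => (Real.exp_pos _).le
  refine (Real.rpow_le_rpow (expSum_pos u α x).le (expSum_le u hα x) hm).trans_eq ?_
  rw [Real.mul_rpow h0 (Real.exp_pos _).le, ← Real.exp_mul]
  congr 2
  ring

theorem abs_le_sum_sum (α : S → ι → ℝ) (σ : S) (k : ι) : |α σ k| ≤ ∑ σ, ∑ k, |α σ k| :=
  (Finset.single_le_sum (f := fun k => |α σ k|) (fun _ _ => abs_nonneg _)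
    (Finset.mem_univ k)).trans
  (Finset.single_le_sum (f := fun σ => ∑ k, |α σ k|)
    (fun _ _ => Finset.sum_nonneg fun _ _ => abs_nonneg _) (Finset.mem_univ σ))

theorem integrable_expSum_rpow [Nonempty S] (u : S → ℝ) (α : S → ι → ℝ) {m : ℝ} (hm : 0 ≤ m) :
    Integrable (fun x => expSum u α x ^ m) (stdGaussian ι) := by
  have hα : ∀ σ k, |α σ k| ≤ ∑ σ, ∑ k, |α σ k| := abs_le_sum_sum α
  refine integrable_of_abs_le_exp (K := (∑ σ, Real.exp (u σ)) ^ m)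
    (c := m * ∑ σ, ∑ k, |α σ k|) (continuous_expSum_rpow u α m).aestronglyMeasurable fun x => ?_
  rw [abs_of_nonneg (Real.rpow_nonneg (expSum_pos u α x).le _)]
  exact expSum_rpow_le u hα hm x

theorem hasDerivAt_sum_mul_update [DecidableEq ι] (a x : ι → ℝ) (k : ι) (y : ℝ) :
    HasDerivAt (fun y => ∑ j, a j * Function.update x k y j) (a k) y := by
  have : HasDerivAt (fun y => ∑ j, a j * Function.update x k y j)
      (∑ j, a j * (Pi.single (M := fun _ => ℝ) k (1 : ℝ)) j) y := by
    refine HasDerivAt.fun_sum fun j _ => HasDerivAt.const_mul _ ?_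
    exact (hasDerivAt_pi.1 (hasDerivAt_update x k y)) j
  simpa [Pi.single_apply] using this

/-- Integration by parts for the Gibbs weight times `W ^ m`. Differentiating `W ^ (m - 1)` brings in
a second replica `τ` with the factor `-(1 - m)`, whose sign decides the comparison below. -/
theorem integral_mul_expSum_rpow [Nonempty S] (u : S → ℝ) (α : S → ι → ℝ) {m : ℝ} (hm : 0 ≤ m)
    (hm1 : m ≤ 1) (σ : S) (k : ι) :
    ∫ x, x k * (expSum u α x ^ (m - 1) * Real.exp (u σ + ∑ j, α σ j * x j)) ∂stdGaussian ι
      = ∫ x, (α σ k * (expSum u α x ^ (m - 1) * Real.exp (u σ + ∑ j, α σ j * x j))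
          - (1 - m) * ∑ τ, α τ k * (expSum u α x ^ (m - 2)
            * Real.exp (u σ + ∑ j, α σ j * x j) * Real.exp (u τ + ∑ j, α τ j * x j)))
        ∂stdGaussian ι := by
  classical
  set M : ℝ := ∑ σ, ∑ k, |α σ k| with hM
  have hα : ∀ σ k, |α σ k| ≤ M := abs_le_sum_sum α
  have hM0 : 0 ≤ M := (abs_nonneg _).trans (hα σ k)
  set W := expSum u α with hW
  set e : S → (ι → ℝ) → ℝ := fun σ x => Real.exp (u σ + ∑ j, α σ j * x j) with he
  have hWpos : ∀ x, 0 < W x := expSum_pos u α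
  have hepos : ∀ σ x, 0 < e σ x := fun σ x => Real.exp_pos _
  have heW : ∀ σ x, e σ x ≤ W x := fun σ x => exp_le_expSum u α x σ
  set K : ℝ := (∑ σ, Real.exp (u σ)) ^ m
  have hK : 0 ≤ K := Real.rpow_nonneg (Finset.sum_nonneg fun _ _ => (Real.exp_pos _).le) _
  have hWm : ∀ x, W x ^ m ≤ K * Real.exp (m * M * ∑ k, |x k|) := expSum_rpow_le u hα hm
  have h1 : ∀ x, W x ^ (m - 1) * e σ x ≤ W x ^ m := by
    intro x
    calc W x ^ (m - 1) * e σ x ≤ W x ^ (m - 1) * W x :=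
          mul_le_mul_of_nonneg_left (heW σ x) (Real.rpow_nonneg (hWpos x).le _)
      _ = W x ^ m := by
          rw [← Real.rpow_add_one (hWpos x).ne']; ring_nf
  have hsumW : ∀ x, ∑ τ, e τ x = W x := fun x => rfl
  have hdσ : ∀ σ x y, HasDerivAt (fun y => e σ (Function.update x k y))
      (e σ (Function.update x k y) * α σ k) y := fun σ x y =>
    ((hasDerivAt_sum_mul_update (α σ) x k y).const_add (u σ)).exp
  have hdW : ∀ x y, HasDerivAt (fun y => W (Function.update x k y))
      (∑ τ, e τ (Function.update x k y) * α τ k) y := fun x y =>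
    HasDerivAt.fun_sum fun τ _ => hdσ τ x y
  have hce : ∀ σ, Continuous (e σ) := fun σ => by simp only [he]; fun_prop
  have hcW : ∀ p : ℝ, Continuous fun x => W x ^ p := continuous_expSum_rpow u α
  -- One constant must bound both functions: `F` needs only `K`, and `F'` needs `2 * M * K`.
  refine integral_mul_stdGaussian k (K := (2 * M + 1) * K) (M := m * M)
    (F := fun x => W x ^ (m - 1) * e σ x)
    (F' := fun x => α σ k * (W x ^ (m - 1) * e σ x)
      - (1 - m) * ∑ τ, α τ k * (W x ^ (m - 2) * e σ x * e τ x)) (fun x y => ?_) ?_ ?_ (by positivity)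
    (fun x => ?_) (fun x => ?_)
  · have := ((hdW x y).rpow_const (p := m - 1) (Or.inl (hWpos _).ne')).mul (hdσ σ x y)
    refine this.congr_deriv ?_
    rw [show m - 1 - 1 = m - 2 by ring, Finset.sum_mul, Finset.sum_mul, Finset.sum_mul,
      Finset.mul_sum, add_comm, sub_eq_add_neg (α σ k * _), ← Finset.sum_neg_distrib]
    refine congrArg₂ _ (by ring) (Finset.sum_congr rfl fun τ _ => by ring)
  · exact (hcW _).mul (hce σ)
  · refine (continuous_const.mul ((hcW _).mul (hce σ))).sub (continuous_const.mul ?_)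
    exact continuous_finsetSum _ fun τ _ =>
      continuous_const.mul (((hcW _).mul (hce σ)).mul (hce τ))
  · rw [abs_of_nonneg (mul_nonneg (Real.rpow_nonneg (hWpos x).le _) (hepos σ x).le)]
    refine ((h1 x).trans (hWm x)).trans ?_
    refine mul_le_mul_of_nonneg_right ?_ (Real.exp_pos _).le
    nlinarith
  · have hA : 0 ≤ W x ^ (m - 1) * e σ x :=
      mul_nonneg (Real.rpow_nonneg (hWpos x).le _) (hepos σ x).le
    have h2 : |∑ τ, α τ k * (W x ^ (m - 2) * e σ x * e τ x)| ≤ M * (W x ^ (m - 1) * e σ x) := by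
      have h3 : W x ^ (m - 1) * e σ x = ∑ τ, W x ^ (m - 2) * e σ x * e τ x := by
        rw [← Finset.mul_sum, hsumW, show m - 1 = m - 2 + 1 by ring,
          Real.rpow_add_one (hWpos x).ne']
        ring
      rw [h3, Finset.mul_sum]
      refine (Finset.abs_sum_le_sum_abs _ _).trans (Finset.sum_le_sum fun τ _ => ?_)
      have h4 : 0 ≤ W x ^ (m - 2) * e σ x * e τ x :=
        mul_nonneg (mul_nonneg (Real.rpow_nonneg (hWpos x).le _) (hepos σ x).le) (hepos τ x).le
      rw [abs_mul, abs_of_nonneg h4]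
      exact mul_le_mul_of_nonneg_right (hα τ k) h4
    calc _ ≤ |α σ k * (W x ^ (m - 1) * e σ x)|
          + |(1 - m) * ∑ τ, α τ k * (W x ^ (m - 2) * e σ x * e τ x)| := abs_sub _ _
      _ ≤ M * (W x ^ (m - 1) * e σ x) + 1 * (M * (W x ^ (m - 1) * e σ x)) := by
          rw [abs_mul, abs_mul (1 - m), abs_of_nonneg hA, abs_of_nonneg (sub_nonneg.2 hm1)]
          refine add_le_add (mul_le_mul_of_nonneg_right (hα σ k) hA) ?_
          exact mul_le_mul (by linarith) h2 (abs_nonneg _) zero_le_one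
      _ = 2 * M * (W x ^ (m - 1) * e σ x) := by ring
      _ ≤ (2 * M + 1) * (K * Real.exp (m * M * ∑ k, |x k|)) :=
          mul_le_mul (by linarith) ((h1 x).trans (hWm x)) hA (by positivity)
      _ = _ := by ring

/-- The derivative in `θ` of the moment of order `m` along the interpolation
`sin θ * a + cos θ * b`. -/
theorem hasDerivAt_integral_expSum_rpow [Nonempty S] (u : S → ℝ) (a b : S → ι → ℝ) {m : ℝ}
    (hm : 0 ≤ m) (hm1 : m ≤ 1) (θ : ℝ) :
    HasDerivAt (fun θ : ℝ => ∫ x, expSum u (fun σ k => Real.sin θ * a σ k + Real.cos θ * b σ k) x ^ m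
        ∂stdGaussian ι)
      (∑ σ, ∑ k, m * (Real.cos θ * a σ k - Real.sin θ * b σ k) * ∫ x, x k *
        (expSum u (fun σ k => Real.sin θ * a σ k + Real.cos θ * b σ k) x ^ (m - 1)
          * Real.exp (u σ + ∑ j, (Real.sin θ * a σ j + Real.cos θ * b σ j) * x j)) ∂stdGaussian ι)
      θ := by
  set M : ℝ := ∑ σ, ∑ k, (|a σ k| + |b σ k|) with hM
  have hab : ∀ σ k, |a σ k| + |b σ k| ≤ M := fun σ k =>
    (Finset.single_le_sum (f := fun k => |a σ k| + |b σ k|) (fun _ _ => by positivity)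
      (Finset.mem_univ k)).trans
    (Finset.single_le_sum (f := fun σ => ∑ k, (|a σ k| + |b σ k|))
      (fun _ _ => Finset.sum_nonneg fun _ _ => by positivity) (Finset.mem_univ σ))
  have hcomb : ∀ s c : ℝ, |s| ≤ 1 → |c| ≤ 1 → ∀ σ k, |s * a σ k + c * b σ k| ≤ M := by
    intro s c hs hc σ k
    refine le_trans (abs_add_le _ _) (le_trans (add_le_add ?_ ?_) (hab σ k)) <;> rw [abs_mul]
    · exact mul_le_of_le_one_left (abs_nonneg _) hs
    · exact mul_le_of_le_one_left (abs_nonneg _) hc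
  set α : ℝ → S → ι → ℝ := fun θ σ k => Real.sin θ * a σ k + Real.cos θ * b σ k with hαdef
  set α' : ℝ → S → ι → ℝ := fun θ σ k => Real.cos θ * a σ k - Real.sin θ * b σ k with hα'def
  have hα : ∀ θ σ k, |α θ σ k| ≤ M := fun θ =>
    hcomb _ _ (Real.abs_sin_le_one θ) (Real.abs_cos_le_one θ)
  have hα' : ∀ θ σ k, |α' θ σ k| ≤ M := fun θ σ k => by
    have := hcomb (Real.cos θ) (-Real.sin θ) (Real.abs_cos_le_one θ)
      (by rw [abs_neg]; exact Real.abs_sin_le_one θ) σ k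
    simpa [hα'def, sub_eq_add_neg] using this
  have hM0 : 0 ≤ M := Finset.sum_nonneg fun _ _ => Finset.sum_nonneg fun _ _ => by positivity
  set e : ℝ → S → (ι → ℝ) → ℝ := fun θ σ x => Real.exp (u σ + ∑ j, α θ σ j * x j) with he
  set W : ℝ → (ι → ℝ) → ℝ := fun θ x => expSum u (α θ) x with hW
  have hWpos : ∀ θ x, 0 < W θ x := fun θ => expSum_pos u (α θ)
  have hepos : ∀ θ σ x, 0 < e θ σ x := fun θ σ x => Real.exp_pos _
  have hsumW : ∀ θ x, ∑ τ, e θ τ x = W θ x := fun θ x => rfl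
  set K : ℝ := (∑ σ, Real.exp (u σ)) ^ m
  have hK : 0 ≤ K := Real.rpow_nonneg (Finset.sum_nonneg fun _ _ => (Real.exp_pos _).le) _
  have hWm : ∀ θ x, W θ x ^ m ≤ K * Real.exp (m * M * ∑ k, |x k|) := fun θ =>
    expSum_rpow_le u (hα θ) hm
  set F' : ℝ → (ι → ℝ) → ℝ := fun θ x =>
    ∑ σ, ∑ k, m * α' θ σ k * (x k * (W θ x ^ (m - 1) * e θ σ x)) with hF'
  have hce : ∀ θ σ, Continuous (e θ σ) := fun θ σ => by simp only [he]; fun_prop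
  have hcW : ∀ θ (p : ℝ), Continuous fun x => W θ x ^ p := fun θ => continuous_expSum_rpow u (α θ)
  have hcF' : ∀ θ, Continuous (F' θ) := fun θ =>
    continuous_finsetSum _ fun σ _ => continuous_finsetSum _ fun k _ =>
      continuous_const.mul ((continuous_apply k).mul ((hcW θ _).mul (hce θ σ)))
  have hterm : ∀ θ σ k x, |x k * (W θ x ^ (m - 1) * e θ σ x)|
      ≤ K * Real.exp ((M + 1) * ∑ k, |x k|) := by
    intro θ σ k x
    have h1 : W θ x ^ (m - 1) * e θ σ x ≤ W θ x ^ m := by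
      calc W θ x ^ (m - 1) * e θ σ x ≤ W θ x ^ (m - 1) * W θ x :=
            mul_le_mul_of_nonneg_left (exp_le_expSum u (α θ) x σ)
              (Real.rpow_nonneg (hWpos θ x).le _)
        _ = W θ x ^ m := by
            rw [← Real.rpow_add_one (hWpos θ x).ne']; ring_nf
    have h2 : |x k| ≤ Real.exp (∑ j, |x j|) := by
      have h2 : |x k| ≤ ∑ j, |x j| :=
        Finset.single_le_sum (f := fun j => |x j|) (fun _ _ => abs_nonneg _) (Finset.mem_univ k)
      linarith [Real.add_one_le_exp (∑ j, |x j|)]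
    have h3 : 0 ≤ W θ x ^ (m - 1) * e θ σ x :=
      mul_nonneg (Real.rpow_nonneg (hWpos θ x).le _) (hepos θ σ x).le
    have h4 : 0 ≤ ∑ k, |x k| := Finset.sum_nonneg fun _ _ => abs_nonneg _
    rw [abs_mul, abs_of_nonneg h3, add_mul, one_mul, Real.exp_add, mul_comm, ← mul_assoc]
    refine mul_le_mul (h1.trans ((hWm θ x).trans ?_)) h2 (abs_nonneg _) (by positivity)
    gcongr
    exact mul_le_of_le_one_left hM0 hm1
  have hterm_int : ∀ θ σ k, Integrable (fun x => x k * (W θ x ^ (m - 1) * e θ σ x))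
      (stdGaussian ι) := fun θ σ k => integrable_of_abs_le_exp
    ((continuous_apply k).mul ((hcW θ _).mul (hce θ σ))).aestronglyMeasurable (hterm θ σ k)
  have hbound : ∀ θ x, ‖F' θ x‖ ≤ ∑ σ : S, ∑ k : ι, M * (K * Real.exp ((M + 1) * ∑ k, |x k|)) := by
    intro θ x
    refine (norm_sum_le _ _).trans (Finset.sum_le_sum fun σ _ => (norm_sum_le _ _).trans
      (Finset.sum_le_sum fun k _ => ?_))
    rw [Real.norm_eq_abs, abs_mul]
    refine mul_le_mul ?_ (hterm θ σ k x) (abs_nonneg _) hM0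
    rw [abs_mul, abs_of_nonneg hm]
    exact (mul_le_of_le_one_left (abs_nonneg _) hm1).trans (hα' θ σ k)
  have hdα : ∀ θ σ k, HasDerivAt (fun θ => α θ σ k) (α' θ σ k) θ := by
    intro θ σ k
    have := ((Real.hasDerivAt_sin θ).mul_const (a σ k)).add
      ((Real.hasDerivAt_cos θ).mul_const (b σ k))
    refine this.congr_deriv ?_
    simp only [hα'def]; ring
  have hde : ∀ θ σ x, HasDerivAt (fun θ => e θ σ x) (e θ σ x * ∑ k, α' θ σ k * x k) θ :=
    fun θ σ x => ((HasDerivAt.fun_sum fun k _ => (hdα θ σ k).mul_const (x k)).const_add (u σ)).exp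
  have hdF : ∀ θ x, HasDerivAt (fun θ => W θ x ^ m) (F' θ x) θ := by
    intro θ x
    have h1 : HasDerivAt (fun θ => W θ x) (∑ σ, e θ σ x * ∑ k, α' θ σ k * x k) θ :=
      HasDerivAt.fun_sum fun σ _ => hde θ σ x
    refine (h1.rpow_const (p := m) (Or.inl (hWpos θ x).ne')).congr_deriv ?_
    simp only [hF', Finset.sum_mul, Finset.mul_sum]
    exact Finset.sum_congr rfl fun σ _ => Finset.sum_congr rfl fun k _ => by ring
  -- Since `|sin|` and `|cos|` are at most `1`, the domination is uniform over all angles, so no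
  -- neighbourhood has to be chosen.
  have hmain := (hasDerivAt_integral_of_dominated_loc_of_deriv_le (μ := stdGaussian ι)
    (F := fun θ x => W θ x ^ m) (F' := F') (x₀ := θ) (s := Set.univ)
    (bound := fun x => ∑ σ : S, ∑ k : ι, M * (K * Real.exp ((M + 1) * ∑ k, |x k|)))
    Filter.univ_mem (Eventually.of_forall fun θ => (hcW θ m).aestronglyMeasurable)
    (integrable_expSum_rpow u (α θ) hm) (hcF' θ).aestronglyMeasurable
    (ae_of_all _ fun x θ _ => hbound θ x)
    (integrable_finsetSum _ fun _ _ => integrable_finsetSum _ fun _ _ =>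
      ((integrable_exp_mul_sum_abs _).const_mul K).const_mul M)
    (ae_of_all _ fun x θ _ => hdF θ x)).2
  refine hmain.congr_deriv ?_
  simp only [hF']
  rw [integral_finsetSum _ fun σ _ => integrable_finsetSum _ fun k _ =>
    (hterm_int θ σ k).const_mul _]
  refine Finset.sum_congr rfl fun σ _ => ?_
  rw [integral_finsetSum _ fun k _ => (hterm_int θ σ k).const_mul _]
  exact Finset.sum_congr rfl fun k _ => integral_const_mul _ _

/-- Guerra's interpolation. Along `sin θ * a + cos θ * b`, integration by parts expresses the
derivative of the moment by covariance differences: the diagonal ones equal `D`, and the two-replica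
ones enter with the factor `-(1 - m) ≤ 0`, so a lower bound `E` on them bounds the derivative above
by a multiple of the moment. The angle avoids the singular endpoint derivatives of `√t`. -/
theorem integral_expSum_rpow_comparison [Nonempty S] (u : S → ℝ) (a b : S → ι → ℝ) {m : ℝ}
    (hm : 0 ≤ m) (hm1 : m ≤ 1) (hab : ∀ σ τ, ∑ k, a σ k * b τ k = 0) {D E : ℝ}
    (hD : ∀ σ, ∑ k, a σ k ^ 2 - ∑ k, b σ k ^ 2 = D)
    (hE : ∀ σ τ, E ≤ ∑ k, a σ k * a τ k - ∑ k, b σ k * b τ k) :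
    ∫ x, expSum u a x ^ m ∂stdGaussian ι
      ≤ Real.exp (m * (D - (1 - m) * E) / 2) * ∫ x, expSum u b x ^ m ∂stdGaussian ι := by
  set α : ℝ → S → ι → ℝ := fun θ σ k => Real.sin θ * a σ k + Real.cos θ * b σ k with hαdef
  set φ : ℝ → ℝ := fun θ => ∫ x, expSum u (α θ) x ^ m ∂stdGaussian ι with hφ
  set B : ℝ := D - (1 - m) * E with hB
  set φ' : ℝ → ℝ := fun θ =>
    (∑ σ, ∑ k, m * (Real.cos θ * a σ k - Real.sin θ * b σ k) * ∫ x, x k *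
        (expSum u (α θ) x ^ (m - 1)
          * Real.exp (u σ + ∑ j, α θ σ j * x j)) ∂stdGaussian ι) with hφ'
  have hd : ∀ θ, HasDerivAt φ (φ' θ) θ := hasDerivAt_integral_expSum_rpow u a b hm hm1
  have hle : ∀ θ, 0 ≤ Real.sin θ * Real.cos θ →
      φ' θ ≤ Real.sin θ * Real.cos θ * m * B * φ θ := by
    intro θ hθ
    set W : (ι → ℝ) → ℝ := expSum u (α θ) with hW
    set e : S → (ι → ℝ) → ℝ := fun σ x => Real.exp (u σ + ∑ j, α θ σ j * x j) with he
    have hWpos : ∀ x, 0 < W x := expSum_pos u (α θ)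
    have hepos : ∀ σ x, 0 < e σ x := fun σ x => Real.exp_pos _
    have heW : ∀ σ x, e σ x ≤ W x := fun σ x => exp_le_expSum u (α θ) x σ
    have hsumW : ∀ x, ∑ τ, e τ x = W x := fun x => rfl
    have hce : ∀ σ, Continuous (e σ) := fun σ => by simp only [he]; fun_prop
    have hcW : ∀ p : ℝ, Continuous fun x => W x ^ p := continuous_expSum_rpow u (α θ)
    have hiW : Integrable (fun x => W x ^ m) (stdGaussian ι) := integrable_expSum_rpow u (α θ) hm
    have hWm1 : ∀ x, W x ^ m = W x ^ (m - 1) * W x := fun x => by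
      rw [← Real.rpow_add_one (hWpos x).ne']; ring_nf
    have hWm2 : ∀ x, W x ^ m = W x ^ (m - 2) * W x * W x := fun x => by
      rw [← Real.rpow_add_one (hWpos x).ne', ← Real.rpow_add_one (hWpos x).ne']; ring_nf
    have hi1 : ∀ σ, Integrable (fun x => W x ^ (m - 1) * e σ x) (stdGaussian ι) := fun σ => by
      refine hiW.mono' ((hcW _).mul (hce σ)).aestronglyMeasurable (ae_of_all _ fun x => ?_)
      have h0 := Real.rpow_nonneg (hWpos x).le (m - 1)
      rw [Real.norm_eq_abs, abs_of_nonneg (mul_nonneg h0 (hepos σ x).le), hWm1]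
      exact mul_le_mul_of_nonneg_left (heW σ x) h0
    have hi2 : ∀ σ τ, Integrable (fun x => W x ^ (m - 2) * e σ x * e τ x) (stdGaussian ι) :=
      fun σ τ => by
      refine hiW.mono' (((hcW _).mul (hce σ)).mul (hce τ)).aestronglyMeasurable
        (ae_of_all _ fun x => ?_)
      have h0 := Real.rpow_nonneg (hWpos x).le (m - 2)
      rw [Real.norm_eq_abs, abs_of_nonneg (mul_nonneg (mul_nonneg h0 (hepos σ x).le)
        (hepos τ x).le), hWm2]
      exact mul_le_mul (mul_le_mul_of_nonneg_left (heW σ x) h0) (heW τ x) (hepos τ x).le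
        (mul_nonneg h0 (hWpos x).le)
    set c := Real.sin θ * Real.cos θ with hc
    set Δ : S → S → ℝ := fun σ τ => ∑ k, a σ k * a τ k - ∑ k, b σ k * b τ k with hΔ
    -- The mixed terms vanish because the families `a` and `b` are uncorrelated.
    have hcov : ∀ σ τ, ∑ k, (Real.cos θ * a σ k - Real.sin θ * b σ k) * α θ τ k = c * Δ σ τ := by
      intro σ τ
      have h1 : ∀ k, (Real.cos θ * a σ k - Real.sin θ * b σ k) * α θ τ k
          = c * (a σ k * a τ k) - c * (b σ k * b τ k) + Real.cos θ ^ 2 * (a σ k * b τ k)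
            - Real.sin θ ^ 2 * (a τ k * b σ k) := fun k => by
        simp only [hαdef, hc]; ring
      simp_rw [h1, Finset.sum_sub_distrib, Finset.sum_add_distrib, Finset.sum_sub_distrib,
        ← Finset.mul_sum, hab]
      simp only [hΔ]; ring
    set I1 : S → ℝ := fun σ => ∫ x, W x ^ (m - 1) * e σ x ∂stdGaussian ι with hI1
    set I2 : S → S → ℝ := fun σ τ => ∫ x, W x ^ (m - 2) * e σ x * e τ x ∂stdGaussian ι with hI2
    have hibp : ∀ σ k, ∫ x, x k * (W x ^ (m - 1) * e σ x) ∂stdGaussian ι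
        = α θ σ k * I1 σ - (1 - m) * ∑ τ, α θ τ k * I2 σ τ := by
      intro σ k
      refine (integral_mul_expSum_rpow u (α θ) hm hm1 σ k).trans ?_
      rw [integral_sub ((hi1 σ).const_mul _)
        ((integrable_finsetSum _ fun τ _ => (hi2 σ τ).const_mul _).const_mul _),
        integral_const_mul, integral_const_mul,
        integral_finsetSum _ fun τ _ => (hi2 σ τ).const_mul _]
      simp_rw [integral_const_mul]
      rfl
    have hsum1 : ∑ σ, I1 σ = φ θ := by
      simp only [hI1, hφ]
      rw [← integral_finsetSum _ fun σ _ => hi1 σ]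
      refine integral_congr_ae (ae_of_all _ fun x => ?_)
      simp only
      rw [← Finset.mul_sum, hsumW, ← hWm1]
    have hsum2 : ∑ σ, ∑ τ, I2 σ τ = φ θ := by
      simp only [hI2, hφ]
      simp_rw [← integral_finsetSum _ fun τ _ => hi2 _ τ]
      rw [← integral_finsetSum _ fun σ _ => integrable_finsetSum _ fun τ _ => hi2 σ τ]
      refine integral_congr_ae (ae_of_all _ fun x => ?_)
      simp only
      simp_rw [← Finset.mul_sum, hsumW, ← Finset.sum_mul, ← Finset.mul_sum, hsumW, ← hWm2]
      rfl
    have hI2nn : ∀ σ τ, 0 ≤ I2 σ τ := fun σ τ => integral_nonneg fun x =>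
      mul_nonneg (mul_nonneg (Real.rpow_nonneg (hWpos x).le _) (hepos σ x).le) (hepos τ x).le
    have heq : φ' θ = c * m * (D * φ θ - (1 - m) * ∑ σ, ∑ τ, Δ σ τ * I2 σ τ) := by
      have h1 : φ' θ = ∑ σ, ((m * (c * Δ σ σ)) * I1 σ
          - (1 - m) * ∑ τ, m * (c * Δ σ τ) * I2 σ τ) := by
        simp only [hφ']
        refine Finset.sum_congr rfl fun σ _ => ?_
        have h2 : ∀ k, m * (Real.cos θ * a σ k - Real.sin θ * b σ k)
            * ∫ x, x k * (W x ^ (m - 1) * e σ x) ∂stdGaussian ι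
            = m * I1 σ * ((Real.cos θ * a σ k - Real.sin θ * b σ k) * α θ σ k)
              - (1 - m) * ∑ τ, m * I2 σ τ
                * ((Real.cos θ * a σ k - Real.sin θ * b σ k) * α θ τ k) := fun k => by
          rw [hibp, mul_sub, ← mul_assoc (m * _) (1 - m), mul_comm (m * _) (1 - m), mul_assoc (1 - m),
            Finset.mul_sum]
          congr 1
          · ring
          · congr 1
            exact Finset.sum_congr rfl fun τ _ => by ring
        rw [Finset.sum_congr rfl fun k _ => h2 k, Finset.sum_sub_distrib, ← Finset.mul_sum,
          ← Finset.mul_sum, Finset.sum_comm, hcov]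
        simp_rw [← Finset.mul_sum, hcov]
        congr 1
        · ring
        · congr 1
          exact Finset.sum_congr rfl fun τ _ => by ring
      have h3 : ∀ σ, Δ σ σ = D := fun σ => by
        rw [← hD σ]; simp only [hΔ, pow_two]
      rw [h1, Finset.sum_sub_distrib, ← Finset.mul_sum]
      simp_rw [h3]
      rw [← Finset.mul_sum, hsum1, mul_sub]
      congr 1
      · ring
      · simp only [Finset.mul_sum]
        exact Finset.sum_congr rfl fun σ _ => Finset.sum_congr rfl fun τ _ => by ring
    have hEle : E * φ θ ≤ ∑ σ, ∑ τ, Δ σ τ * I2 σ τ := by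
      rw [← hsum2, Finset.mul_sum]
      refine Finset.sum_le_sum fun σ _ => ?_
      rw [Finset.mul_sum]
      exact Finset.sum_le_sum fun τ _ => mul_le_mul_of_nonneg_right (hE σ τ) (hI2nn σ τ)
    rw [heq, mul_assoc (c * m)]
    refine mul_le_mul_of_nonneg_left ?_ (mul_nonneg hθ hm)
    have := mul_le_mul_of_nonneg_left hEle (sub_nonneg.2 hm1)
    rw [hB, sub_mul]
    linarith
  -- Grönwall's argument: the integrating factor comes from the primitive `sin θ ^ 2 / 2` of `sin θ
  -- * cos θ`.
  set ψ : ℝ → ℝ := fun θ => Real.exp (-(m * B / 2 * Real.sin θ ^ 2)) * φ θ with hψ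
  have hdψ : ∀ θ, HasDerivAt ψ (Real.exp (-(m * B / 2 * Real.sin θ ^ 2))
      * (φ' θ - Real.sin θ * Real.cos θ * m * B * φ θ)) θ := by
    intro θ
    have h1 : HasDerivAt (fun θ => -(m * B / 2 * Real.sin θ ^ 2))
        (-(m * B * (Real.sin θ * Real.cos θ))) θ := by
      refine ((((Real.hasDerivAt_sin θ).pow 2).const_mul (m * B / 2)).neg).congr_deriv ?_
      push_cast; ring
    refine (h1.exp.mul (hd θ)).congr_deriv ?_
    ring
  have hanti : AntitoneOn ψ (Set.Icc 0 (Real.pi / 2)) := by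
    refine antitoneOn_of_deriv_nonpos (convex_Icc _ _)
      (fun θ _ => (hdψ θ).continuousAt.continuousWithinAt)
      (fun θ _ => (hdψ θ).differentiableAt.differentiableWithinAt) fun θ hθ => ?_
    rw [interior_Icc] at hθ
    rw [(hdψ θ).deriv]
    refine mul_nonpos_of_nonneg_of_nonpos (Real.exp_pos _).le (sub_nonpos.2 (hle θ ?_))
    exact mul_nonneg (Real.sin_nonneg_of_nonneg_of_le_pi hθ.1.le (by linarith [hθ.2, Real.pi_pos]))
      (Real.cos_nonneg_of_mem_Icc ⟨by linarith [hθ.1, Real.pi_pos], hθ.2.le⟩)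
  have hpi : (0 : ℝ) ≤ Real.pi / 2 := by positivity
  have := hanti (Set.left_mem_Icc.2 hpi) (Set.right_mem_Icc.2 hpi) hpi
  simp only [hψ, hφ, hαdef, Real.sin_zero, Real.cos_zero, Real.sin_pi_div_two,
    Real.cos_pi_div_two, zero_mul, one_mul, zero_add, add_zero, one_pow, mul_one, ne_eq,
    OfNat.ofNat_ne_zero, not_false_eq_true, zero_pow, mul_zero, neg_zero, Real.exp_zero] at this
  rw [Real.exp_neg, inv_mul_le_iff₀ (Real.exp_pos _)] at this
  convert! this using 2

end ExpSum

/-! ### Reduction of the multiscale recursion to moments of a one-scale model -/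

section Scales

variable {N : ℕ}

/-- The coefficient of the coupling `g p` in the energy of `σ`. -/
noncomputable def coef (σ : Config N) (p : Fin N × Fin N) : ℝ :=
  spin σ p.1 * spin σ p.2 / √(N : ℝ)

/-- The normalized energy of all the configurations. -/
noncomputable def energy (x : Couplings N) (σ : Config N) : ℝ := ∑ p, coef σ p * x p

theorem levelHamiltonian_eq {r : ℕ} (γ : Fin (r + 1) → ℝ) (i : Fin r) (g : Couplings N)
    (σ : Config N) :
    levelHamiltonian γ i g σ = √(γ i.succ ^ 2 - γ i.castSucc ^ 2) * energy g σ := by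
  rw [levelHamiltonian, energy, Fintype.sum_prod_type]
  congr 1
  exact Finset.sum_congr rfl fun a _ => Finset.sum_congr rfl fun b _ => by
    simp only [coef]; ring

/-- The moment of order `m` of the partition function with log-weights `u` and inverse
temperature `c`. -/
noncomputable def moment (m c : ℝ) (u : Config N → ℝ) : ℝ :=
  ∫ x, expSum u (fun σ p => -c * coef σ p) x ^ m ∂stdGaussian (Fin N × Fin N)

theorem expSum_coef (c : ℝ) (u : Config N → ℝ) (x : Couplings N) :
    expSum u (fun σ p => -c * coef σ p) x = ∑ σ, Real.exp (u σ - c * energy x σ) := by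
  simp only [expSum, energy, Finset.mul_sum, sub_eq_add_neg, ← Finset.sum_neg_distrib]
  refine Finset.sum_congr rfl fun σ _ => ?_
  congr 2
  exact Finset.sum_congr rfl fun p _ => by ring

theorem expSum_le_exp_norm_mul {S ι : Type*} [Fintype S] [Fintype ι] (u v : S → ℝ)
    (α : S → ι → ℝ) (x : ι → ℝ) : expSum u α x ≤ Real.exp ‖u - v‖ * expSum v α x := by
  rw [expSum, expSum, Finset.mul_sum]
  refine Finset.sum_le_sum fun σ _ => ?_
  rw [← Real.exp_add]
  refine Real.exp_le_exp.2 ?_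
  have := (le_abs_self _).trans (norm_le_pi_norm (u - v) σ)
  simp only [Pi.sub_apply] at this
  linarith

/-- Positive functionals of the log-weights whose logarithm is `1`-Lipschitz. -/
structure LogLipschitz (A : (Config N → ℝ) → ℝ) : Prop where
  pos : ∀ u, 0 < A u
  le : ∀ u v, A u ≤ Real.exp ‖u - v‖ * A v

theorem LogLipschitz.abs_log_sub_le {A : (Config N → ℝ) → ℝ} (hA : LogLipschitz A)
    (u v : Config N → ℝ) : |Real.log (A u) - Real.log (A v)| ≤ ‖u - v‖ := by
  have key : ∀ u v, Real.log (A u) ≤ ‖u - v‖ + Real.log (A v) := fun u v => by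
    have := Real.log_le_log (hA.pos u) (hA.le u v)
    rwa [Real.log_mul (Real.exp_pos _).ne' (hA.pos v).ne', Real.log_exp] at this
  have h1 := key u v
  have h2 := key v u
  rw [norm_sub_rev] at h2
  exact abs_le.2 ⟨by linarith, by linarith⟩

theorem LogLipschitz.continuous_log {A : (Config N → ℝ) → ℝ} (hA : LogLipschitz A) :
    Continuous fun u => Real.log (A u) := by
  refine (LipschitzWith.of_dist_le_mul (K := 1) fun u v => ?_).continuous
  rw [Real.dist_eq, dist_eq_norm, NNReal.coe_one, one_mul]
  exact hA.abs_log_sub_le u v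

theorem LogLipschitz.continuous {A : (Config N → ℝ) → ℝ} (hA : LogLipschitz A) :
    Continuous A := by
  have := Real.continuous_exp.comp hA.continuous_log
  refine this.congr fun u => ?_
  simp [Real.exp_log (hA.pos u)]

@[fun_prop]
theorem continuous_energy : Continuous (energy : Couplings N → Config N → ℝ) := by
  unfold energy; fun_prop

theorem exists_norm_energy_le (N : ℕ) :
    ∃ M : ℝ, 0 ≤ M ∧ ∀ x : Couplings N, ‖energy x‖ ≤ M * ∑ p, |x p| := by
  refine ⟨∑ σ : Config N, ∑ p, |coef σ p|,
    Finset.sum_nonneg fun _ _ => Finset.sum_nonneg fun _ _ => abs_nonneg _, fun x => ?_⟩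
  refine (pi_norm_le_iff_of_nonneg (by positivity)).2 fun σ => ?_
  exact abs_sum_mul_le (abs_le_sum_sum coef σ) x

/-- The energy is linear in the couplings, so a functional with Lipschitz logarithm grows at most
exponentially in them. -/
theorem LogLipschitz.integrable_rpow {A : (Config N → ℝ) → ℝ} (hA : LogLipschitz A)
    (u : Config N → ℝ) (d : ℝ) {p : ℝ} (hp : 0 ≤ p) :
    Integrable (fun x => A (u - d • energy x) ^ p) (couplingLaw N) := by
  obtain ⟨M, hM0, hM⟩ := exists_norm_energy_le N
  refine integrable_of_abs_le_exp (K := A u ^ p) (c := p * (|d| * M))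
    (Continuous.aestronglyMeasurable ?_) fun x => ?_
  · exact (hA.continuous.comp (by fun_prop)).rpow_const fun x => Or.inl (hA.pos _).ne'
  · rw [abs_of_nonneg (Real.rpow_nonneg (hA.pos _).le _)]
    have h1 : A (u - d • energy x) ≤ Real.exp (|d| * M * ∑ p, |x p|) * A u := by
      refine (hA.le _ u).trans (mul_le_mul_of_nonneg_right (Real.exp_le_exp.2 ?_) (hA.pos u).le)
      rw [sub_sub_cancel_left, norm_neg, norm_smul, Real.norm_eq_abs, mul_assoc]
      exact mul_le_mul_of_nonneg_left (hM x) (abs_nonneg d)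
    refine (Real.rpow_le_rpow (hA.pos _).le h1 hp).trans_eq ?_
    rw [Real.mul_rpow (Real.exp_pos _).le (hA.pos u).le, ← Real.exp_mul, mul_comm]
    congr 2
    ring

theorem moment_pos (m c : ℝ) (hm : 0 ≤ m) (u : Config N → ℝ) : 0 < moment m c u := by
  refine (integral_pos_iff_support_of_nonneg (fun x => Real.rpow_nonneg (expSum_pos _ _ _).le _)
    (integrable_expSum_rpow _ _ hm)).2 ?_
  have : Function.support (fun x => expSum u (fun σ p => -c * coef σ p) x ^ m) = Set.univ :=
    Set.eq_univ_of_forall fun x => (Real.rpow_pos_of_pos (expSum_pos _ _ _) _).ne'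
  rw [this, measure_univ]
  exact one_pos

theorem logLipschitz_moment {m : ℝ} (c : ℝ) (hm : 0 ≤ m) (hm1 : m ≤ 1) :
    LogLipschitz (moment m c : (Config N → ℝ) → ℝ) := by
  refine ⟨moment_pos m c hm, fun u v => ?_⟩
  rw [moment, moment, ← integral_const_mul]
  refine integral_mono (integrable_expSum_rpow _ _ hm)
    ((integrable_expSum_rpow _ _ hm).const_mul _) fun x => ?_
  refine (Real.rpow_le_rpow (expSum_pos _ _ _).le (expSum_le_exp_norm_mul u v _ x) hm).trans ?_
  rw [Real.mul_rpow (Real.exp_pos _).le (expSum_pos _ _ _).le, ← Real.exp_mul]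
  refine mul_le_mul_of_nonneg_right (Real.exp_le_exp.2 ?_)
    (Real.rpow_nonneg (expSum_pos _ _ _).le _)
  exact mul_le_of_le_one_right (norm_nonneg _) hm1

/-- Averaging over a further independent scale of strength `d` adds variances, hence replaces `c` by
`√(d ^ 2 + c ^ 2)` without changing the order `m`. -/
theorem integral_moment {m : ℝ} (c d : ℝ) (hm : 0 ≤ m) (u : Config N → ℝ) :
    ∫ y, moment m c (u - d • energy y) ∂couplingLaw N = moment m (√(d ^ 2 + c ^ 2)) u := by
  set f : Couplings N → ℝ := fun z => expSum u (fun σ p => -coef σ p) z ^ m with hf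
  have h1 : ∀ y : Couplings N, moment m c (u - d • energy y)
      = ∫ x, f (fun k => d * y k + c * x k) ∂stdGaussian (Fin N × Fin N) := by
    intro y
    refine integral_congr_ae (ae_of_all _ fun x => ?_)
    simp only [hf, expSum]
    congr 1
    refine Finset.sum_congr rfl fun σ _ => ?_
    congr 1
    simp only [Pi.sub_apply, Pi.smul_apply, smul_eq_mul, energy, Finset.mul_sum, sub_eq_add_neg,
      ← Finset.sum_neg_distrib, add_assoc, ← Finset.sum_add_distrib]
    congr 1
    exact Finset.sum_congr rfl fun p _ => by ring
  simp_rw [h1]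
  refine (integral_integral_add_stdGaussian d c (continuous_expSum_rpow _ _ m)
    (K := (∑ σ, Real.exp (u σ)) ^ m)
    (M := m * ∑ σ : Config N, ∑ p, |-coef σ p|) fun x => ?_).trans ?_
  · rw [abs_of_nonneg (Real.rpow_nonneg (expSum_pos _ _ _).le _)]
    exact expSum_rpow_le u (abs_le_sum_sum _) hm x
  · refine integral_congr_ae (ae_of_all _ fun x => ?_)
    simp only [expSum]
    congr 1
    refine Finset.sum_congr rfl fun σ _ => ?_
    congr 2
    exact Finset.sum_congr rfl fun p _ => by ring

theorem rpow_integral_le {α : Type*} [MeasurableSpace α] {μ : Measure α} [IsProbabilityMeasure μ]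
    {f : α → ℝ} {p : ℝ} (hp : 1 ≤ p) (hf : ∀ x, 0 ≤ f x) (hfi : Integrable f μ)
    (hfp : Integrable (fun x => f x ^ p) μ) : (∫ x, f x ∂μ) ^ p ≤ ∫ x, f x ^ p ∂μ :=
  (convexOn_rpow hp).map_integral_le
    (continuousOn_id.rpow_const fun _ _ => Or.inr (zero_le_one.trans hp)) isClosed_Ici
    (ae_of_all _ hf) hfi hfp

/-- Functionals of the log-weights lying between the moments of orders `a` and `b`. -/
structure IsBetweenMoments (a b c : ℝ) (A : (Config N → ℝ) → ℝ) : Prop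
    extends LogLipschitz A where
  lower : ∀ u, moment a c u ≤ A u ^ a
  upper : ∀ u, A u ^ b ≤ moment b c u

/-- `L^p` norms increase with `p`, so the `L^ζ` norm over one scale lies between those of orders `a`
and `b`; inserting the bounds already known for `A` turns these into moments with the new scale
merged in. -/
theorem IsBetweenMoments.average {a b c d ζ : ℝ} {A : (Config N → ℝ) → ℝ}
    (hA : IsBetweenMoments a b c A) (ha : 0 < a) (haζ : a ≤ ζ) (hζb : ζ ≤ b) (hb : b ≤ 1) :
    IsBetweenMoments a b (√(d ^ 2 + c ^ 2))
      (fun u => (∫ x, A (u - d • energy x) ^ ζ ∂couplingLaw N) ^ (1 / ζ)) := by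
  have hζ : 0 < ζ := ha.trans_le haζ
  have hb0 : 0 < b := hζ.trans_le hζb
  have hL := hA.toLogLipschitz
  have : IsProbabilityMeasure (couplingLaw N) := by unfold couplingLaw; infer_instance
  have hpos : ∀ u, 0 < ∫ x, A (u - d • energy x) ^ ζ ∂couplingLaw N := fun u => by
    refine (integral_pos_iff_support_of_nonneg (fun x => Real.rpow_nonneg (hL.pos _).le _)
      (hL.integrable_rpow u d hζ.le)).2 ?_
    rw [Set.eq_univ_of_forall (s := Function.support _) fun x =>
      (Real.rpow_pos_of_pos (hL.pos (u - d • energy x)) ζ).ne', measure_univ]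
    exact one_pos
  -- Jensen's inequality for the convex power `q / p ≥ 1`; it is used with `(p, q) = (a, ζ)` and
  -- `(ζ, b)`.
  have hle : ∀ (u : Config N → ℝ) (p q : ℝ), 0 < p → p ≤ q →
      (∫ x, A (u - d • energy x) ^ p ∂couplingLaw N) ^ (q / p)
        ≤ ∫ x, A (u - d • energy x) ^ q ∂couplingLaw N := by
    intro u p q hp hpq
    have hpp : ∀ x, (A (u - d • energy x) ^ p) ^ (q / p) = A (u - d • energy x) ^ q := fun x => by
      rw [← Real.rpow_mul (hL.pos _).le, mul_div_cancel₀ _ hp.ne']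
    have := rpow_integral_le (μ := couplingLaw N) (f := fun x => A (u - d • energy x) ^ p)
      (p := q / p) ((one_le_div hp).2 hpq) (fun x => Real.rpow_nonneg (hL.pos _).le _)
      (hL.integrable_rpow u d hp.le)
      (by simp_rw [hpp]; exact hL.integrable_rpow u d (hp.le.trans hpq))
    simpa only [hpp] using this
  refine ⟨⟨fun u => Real.rpow_pos_of_pos (hpos u) _, fun u v => ?_⟩, fun u => ?_, fun u => ?_⟩
  · have h1 : ∫ x, A (u - d • energy x) ^ ζ ∂couplingLaw N
        ≤ Real.exp (‖u - v‖ * ζ) * ∫ x, A (v - d • energy x) ^ ζ ∂couplingLaw N := by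
      rw [← integral_const_mul]
      refine integral_mono (hL.integrable_rpow u d hζ.le)
        ((hL.integrable_rpow v d hζ.le).const_mul _) fun x => ?_
      have h2 := hL.le (u - d • energy x) (v - d • energy x)
      rw [sub_sub_sub_cancel_right] at h2
      refine (Real.rpow_le_rpow (hL.pos _).le h2 hζ.le).trans_eq ?_
      rw [Real.mul_rpow (Real.exp_pos _).le (hL.pos _).le, ← Real.exp_mul]
    refine (Real.rpow_le_rpow (hpos u).le h1 (by positivity)).trans_eq ?_
    rw [Real.mul_rpow (Real.exp_pos _).le (hpos v).le, ← Real.exp_mul, mul_assoc,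
      mul_one_div_cancel hζ.ne', mul_one]
  · rw [← integral_moment c d ha.le u, ← Real.rpow_mul (hpos u).le]
    have h1 : ∫ y, moment a c (u - d • energy y) ∂couplingLaw N
        ≤ ∫ y, A (u - d • energy y) ^ a ∂couplingLaw N := by
      refine integral_mono ?_ (hL.integrable_rpow u d ha.le) fun y => hA.lower _
      simpa using (logLipschitz_moment c ha.le (haζ.trans (hζb.trans hb))).integrable_rpow u d
        zero_le_one
    have h0 : 0 ≤ ∫ y, A (u - d • energy y) ^ a ∂couplingLaw N :=
      integral_nonneg fun x => Real.rpow_nonneg (hL.pos _).le _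
    refine h1.trans ?_
    have h2 := Real.rpow_le_rpow (z := a / ζ) (Real.rpow_nonneg h0 _) (hle u a ζ ha haζ)
      (by positivity)
    rw [← Real.rpow_mul h0, div_mul_div_cancel₀ ha.ne', div_self hζ.ne', Real.rpow_one] at h2
    rwa [one_div_mul_eq_div]
  · rw [← integral_moment c d hb0.le u, ← Real.rpow_mul (hpos u).le, one_div_mul_eq_div]
    refine (hle u ζ b hζ hζb).trans ?_
    refine integral_mono (hL.integrable_rpow u d hb0.le) ?_ fun y => hA.upper _
    simpa using (logLipschitz_moment c hb0.le hb).integrable_rpow u d zero_le_one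

/-- At `c = 0` nothing is random, so both bounds are equalities. This starts the downward induction.
-/
theorem isBetweenMoments_sum_exp (a b : ℝ) :
    IsBetweenMoments a b 0 (fun u : Config N → ℝ => ∑ σ, Real.exp (u σ)) := by
  have h : ∀ m (u : Config N → ℝ), moment m 0 u = (∑ σ, Real.exp (u σ)) ^ m := fun m u => by
    simp [moment, expSum]
  refine ⟨⟨fun u => Finset.sum_pos (fun _ _ => Real.exp_pos _) Finset.univ_nonempty,
    fun u v => ?_⟩, fun u => (h a u).le, fun u => (h b u).ge⟩
  simpa [expSum] using expSum_le_exp_norm_mul u v (fun (_ : Config N) (_ : Fin 0) => (0 : ℝ)) 0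

/-- The log-weights given by the external fields. -/
noncomputable def fieldWeight (h : Fin N → ℝ) (σ : Config N) : ℝ := -∑ a, h a * spin σ a

/-- Couplings that are not yet averaged act only as a shift of the log-weights. `Z_ℓ` is therefore a
single functional `A` evaluated at a shifted weight, and the variances of the averaged scales
telescope to `γ_r ^ 2 - γ_ℓ ^ 2`. -/
theorem exists_isBetweenMoments_multiscaleZ {r : ℕ} (ζ γ : Fin (r + 1) → ℝ) (N : ℕ) {a b : ℝ}
    (ha : 0 < a) (hb : b ≤ 1) (haζ : ∀ i : Fin r, a ≤ ζ i.castSucc)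
    (hζb : ∀ i : Fin r, ζ i.castSucc ≤ b) (hγ : Monotone fun i => γ i ^ 2)
    (ℓ : Fin (r + 1)) :
    ∃ A : (Config N → ℝ) → ℝ,
      IsBetweenMoments a b (√(γ (Fin.last r) ^ 2 - γ ℓ ^ 2)) A ∧
      ∀ (h : Fin N → ℝ) (g : Fin ℓ → Couplings N), multiscaleZ ζ γ h ℓ g
        = A (fieldWeight h - fun σ => ∑ i : Fin ℓ,
            levelHamiltonian γ (Fin.castLE (Nat.lt_succ_iff.1 ℓ.2) i) (g i) σ) := by
  induction ℓ using Fin.reverseInduction with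
  | last =>
    refine ⟨_, by simpa using isBetweenMoments_sum_exp a b, fun h g => ?_⟩
    refine (multiscaleZ_last ζ γ h g).trans ?_
    simp only [partitionFunction, hamiltonian, fieldWeight, Pi.sub_apply]
    refine Finset.sum_congr rfl fun σ _ => ?_
    congr 1
    rw [neg_sub_left, sub_eq_add_neg, ← neg_add]
    rfl
  | cast i ih =>
    obtain ⟨A, hA, hZ⟩ := ih
    set d := √(γ i.succ ^ 2 - γ i.castSucc ^ 2) with hd
    refine ⟨fun u => (∫ x, A (u - d • energy x) ^ ζ i.castSucc ∂couplingLaw N)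
      ^ (1 / ζ i.castSucc), ?_, fun h g => ?_⟩
    · have h1 := hA.average (d := d) ha (haζ i) (hζb i) hb
      have h2 : d ^ 2 + √(γ (Fin.last r) ^ 2 - γ i.succ ^ 2) ^ 2
          = γ (Fin.last r) ^ 2 - γ i.castSucc ^ 2 := by
        have e1 : γ i.castSucc ^ 2 ≤ γ i.succ ^ 2 := hγ (Fin.castSucc_lt_succ).le
        have e2 : γ i.succ ^ 2 ≤ γ (Fin.last r) ^ 2 := hγ (Fin.le_last _)
        rw [hd, Real.sq_sqrt (by linarith), Real.sq_sqrt (by linarith)]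
        ring
      rw [h2] at h1
      exact h1
    · rw [multiscaleZ_castSucc]
      congr 1
      refine integral_congr_ae (ae_of_all _ fun x => ?_)
      simp only
      rw [hZ]
      congr 2
      ext σ
      simp only [Pi.sub_apply, Pi.smul_apply, smul_eq_mul]
      rw [sub_sub]
      congr 1
      -- The last summand is the scale being averaged; the others are the shift already present at
      -- level `i`.
      refine (Fin.sum_univ_castSucc (n := (i : ℕ)) _).trans ?_
      congr 1
      · refine Finset.sum_congr rfl fun j _ => ?_
        rw [Fin.snoc_castSucc (α := fun _ => Couplings N)]
        rfl
      · rw [Fin.snoc_last (α := fun _ => Couplings N)]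
        exact levelHamiltonian_eq γ i x σ

end Scales

/-! ### From the first two moments to fractional moments -/

section SecondMoment

variable {S ι : Type*} [Fintype S] [Fintype ι]

theorem integrable_expSum [Nonempty S] (u : S → ℝ) (α : S → ι → ℝ) :
    Integrable (expSum u α) (stdGaussian ι) := by
  simpa using integrable_expSum_rpow u α zero_le_one

theorem integral_exp_add_sum_mul (c : ℝ) (a : ι → ℝ) :
    ∫ x, Real.exp (c + ∑ k, a k * x k) ∂stdGaussian ι = Real.exp (c + (∑ k, a k ^ 2) / 2) := by
  simp_rw [Real.exp_add]
  rw [integral_const_mul, integral_exp_sum_mul]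

theorem integrable_exp_add_sum_mul (c : ℝ) (a : ι → ℝ) :
    Integrable (fun x => Real.exp (c + ∑ k, a k * x k)) (stdGaussian ι) := by
  simp_rw [Real.exp_add]
  exact (integrable_exp_sum_mul a).const_mul _

theorem integral_expSum (u : S → ℝ) (α : S → ι → ℝ) :
    ∫ x, expSum u α x ∂stdGaussian ι = ∑ σ, Real.exp (u σ + (∑ k, α σ k ^ 2) / 2) := by
  unfold expSum
  rw [integral_finsetSum _ fun σ _ => integrable_exp_add_sum_mul _ _]
  simp_rw [integral_exp_add_sum_mul]

theorem integral_expSum_sq (u : S → ℝ) (α : S → ι → ℝ) :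
    ∫ x, expSum u α x ^ 2 ∂stdGaussian ι
      = ∑ σ, ∑ τ, Real.exp (u σ + u τ + (∑ k, (α σ k + α τ k) ^ 2) / 2) := by
  have h : ∀ x : ι → ℝ, expSum u α x ^ 2
      = ∑ σ, ∑ τ, Real.exp (u σ + u τ + ∑ k, (α σ k + α τ k) * x k) := by
    intro x
    rw [pow_two, expSum, Finset.sum_mul_sum]
    refine Finset.sum_congr rfl fun σ _ => Finset.sum_congr rfl fun τ _ => ?_
    rw [← Real.exp_add]
    simp_rw [add_mul, Finset.sum_add_distrib]
    congr 1
    ring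
  simp_rw [h]
  rw [integral_finsetSum _ fun σ _ => integrable_finsetSum _ fun τ _ =>
    integrable_exp_add_sum_mul _ _]
  refine Finset.sum_congr rfl fun σ _ => ?_
  rw [integral_finsetSum _ fun τ _ => integrable_exp_add_sum_mul _ _]
  simp_rw [integral_exp_add_sum_mul]

theorem sub_sq_le_rpow {y m : ℝ} (hy : 0 ≤ y) (hm1 : m ≤ 1) : y - y ^ 2 ≤ y ^ m := by
  rcases le_or_gt y 1 with h | h
  · rcases hy.eq_or_lt with rfl | hy'
    · simpa using Real.rpow_nonneg le_rfl m
    · have := Real.rpow_le_rpow_of_exponent_ge hy' h hm1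
      rw [Real.rpow_one] at this
      nlinarith [sq_nonneg y]
  · have := Real.rpow_nonneg hy m
    nlinarith

/-- A lower bound for fractional moments from the first two moments. -/
theorem rpow_integral_expSum_le [Nonempty S] (u : S → ℝ) (α : S → ι → ℝ) {m C : ℝ} (hm : 0 ≤ m)
    (hm1 : m ≤ 1) (hC : 1 ≤ C)
    (h2 : ∫ x, expSum u α x ^ 2 ∂stdGaussian ι ≤ C * (∫ x, expSum u α x ∂stdGaussian ι) ^ 2) :
    (∫ x, expSum u α x ∂stdGaussian ι) ^ m / (4 * C)
      ≤ ∫ x, expSum u α x ^ m ∂stdGaussian ι := by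
  set A := ∫ x, expSum u α x ∂stdGaussian ι with hA
  have hApos : 0 < A := by
    rw [hA, integral_expSum]
    exact Finset.sum_pos (fun _ _ => Real.exp_pos _) Finset.univ_nonempty
  -- The value `K = 2 * C * A` maximizes `A / K - C * A ^ 2 / K ^ 2`, with maximum `1 / (4 * C)`.
  set K := 2 * C * A with hK
  have hKpos : 0 < K := by positivity
  have hAK : A ≤ K := by rw [hK]; nlinarith
  have hsq : Integrable (fun x => expSum u α x ^ 2) (stdGaussian ι) := by
    simpa using integrable_expSum_rpow u α (m := 2) zero_le_two
  have h1 : A / K - (∫ x, expSum u α x ^ 2 ∂stdGaussian ι) / K ^ 2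
      ≤ (∫ x, expSum u α x ^ m ∂stdGaussian ι) / K ^ m := by
    rw [hA, ← integral_div, ← integral_div, ← integral_div, ← integral_sub
      ((integrable_expSum u α).div_const _) (hsq.div_const _)]
    refine integral_mono (((integrable_expSum u α).div_const _).sub (hsq.div_const _))
      ((integrable_expSum_rpow u α hm).div_const _) fun x => ?_
    have := sub_sq_le_rpow (div_nonneg (expSum_pos u α x).le hKpos.le) hm1
    rwa [div_pow, Real.div_rpow (expSum_pos u α x).le hKpos.le] at this
  have h3 : 1 / (4 * C) ≤ A / K - (∫ x, expSum u α x ^ 2 ∂stdGaussian ι) / K ^ 2 := by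
    have h4 : (∫ x, expSum u α x ^ 2 ∂stdGaussian ι) / K ^ 2 ≤ C * A ^ 2 / K ^ 2 := by gcongr
    have h5 : A / K - C * A ^ 2 / K ^ 2 = 1 / (4 * C) := by
      rw [hK]; field_simp; ring
    linarith
  have h6 := h3.trans h1
  rw [le_div_iff₀ (Real.rpow_pos_of_pos hKpos m)] at h6
  refine le_trans ?_ h6
  rw [one_div_mul_eq_div]
  gcongr

end SecondMoment

/-! ### Second moment in a weak field up to the critical temperature -/

section Spins

variable {N : ℕ}

theorem sum_config_prod (f : Fin N → ℝ → ℝ) :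
    ∑ σ : Config N, ∏ a, f a (spin σ a) = ∏ a, (f a 1 + f a (-1)) := by
  have h := Finset.prod_univ_sum (fun _ : Fin N => (Finset.univ : Finset ℤˣ))
    (fun a s => f a ((s : ℤ) : ℝ))
  rw [Fintype.piFinset_univ] at h
  refine Eq.trans h.symm (Finset.prod_congr rfl fun a _ => ?_)
  rw [UnitsInt.univ, Finset.sum_pair (by decide)]
  simp

theorem sum_config_exp (y : Fin N → ℝ) :
    ∑ σ : Config N, Real.exp (∑ a, y a * spin σ a) = ∏ a, (2 * Real.cosh (y a)) := by
  simp_rw [Real.exp_sum]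
  rw [sum_config_prod (fun a s => Real.exp (y a * s))]
  refine Finset.prod_congr rfl fun a _ => ?_
  rw [Real.cosh_eq, mul_one, mul_neg_one]
  ring

theorem spin_sq (σ : Config N) (a : Fin N) : spin σ a ^ 2 = 1 := by
  rcases Int.units_eq_one_or (σ a) with h | h <;> simp [spin, h]

theorem abs_spin (σ : Config N) (a : Fin N) : |spin σ a| = 1 := by
  rcases Int.units_eq_one_or (σ a) with h | h <;> simp [spin, h]

/-- A general vector `v` is allowed because both `v = spin τ` (overlaps) and `v = tanh h` (the tilt)
are needed. -/
theorem sum_coef_mul (v : Fin N → ℝ) (σ : Config N) :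
    ∑ p : Fin N × Fin N, coef σ p * (v p.1 * v p.2 / √(N : ℝ))
      = (∑ a, v a * spin σ a) ^ 2 / N := by
  rw [Fintype.sum_prod_type, pow_two, Finset.sum_mul_sum, Finset.sum_div]
  refine Finset.sum_congr rfl fun a _ => ?_
  rw [Finset.sum_div]
  refine Finset.sum_congr rfl fun b _ => ?_
  rw [coef, div_mul_div_comm, Real.mul_self_sqrt (Nat.cast_nonneg N)]
  congr 1
  ring

theorem sum_coef_mul_coef (σ τ : Config N) :
    ∑ p, coef σ p * coef τ p = (∑ a, spin τ a * spin σ a) ^ 2 / N :=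
  sum_coef_mul (spin τ) σ

theorem sum_coef_sq (σ : Config N) : ∑ p, coef σ p ^ 2 = N := by
  simp_rw [pow_two, sum_coef_mul_coef, ← pow_two, spin_sq]
  rcases Nat.eq_zero_or_pos N with rfl | hN
  · simp
  · simp only [Finset.sum_const, Finset.card_univ, Fintype.card_fin, nsmul_eq_mul, mul_one]
    field_simp

theorem sum_exp_fieldWeight (h : Fin N → ℝ) :
    ∑ σ : Config N, Real.exp (fieldWeight h σ) = ∏ a, (2 * Real.cosh (h a)) := by
  have := sum_config_exp (fun a => -h a)
  simp only [Real.cosh_neg] at this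
  rw [← this]
  refine Finset.sum_congr rfl fun σ _ => ?_
  simp [fieldWeight]

theorem integral_expSum_coef (c : ℝ) (u : Config N → ℝ) :
    ∫ x, expSum u (fun σ p => -c * coef σ p) x ∂stdGaussian (Fin N × Fin N)
      = Real.exp (c ^ 2 * N / 2) * ∑ σ, Real.exp (u σ) := by
  rw [integral_expSum, Finset.mul_sum]
  refine Finset.sum_congr rfl fun σ _ => ?_
  simp_rw [mul_pow, ← Finset.mul_sum, sum_coef_sq, neg_sq]
  rw [add_comm, Real.exp_add]

/-- The negative quartic term matters: at `c ^ 2 = 1/2` the quadratic terms cancel and it alone has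
to beat the field. The constant `48` is not sharp; `log cosh` has quartic coefficient `-1/12`. -/
theorem cosh_le_exp_of_abs_le_one {x : ℝ} (hx : |x| ≤ 1) :
    Real.cosh x ≤ Real.exp (x ^ 2 / 2 - x ^ 4 / 48) := by
  have h1 := (abs_le.1 (Real.exp_bound hx (n := 4) (by norm_num))).2
  have h2 := (abs_le.1 (Real.exp_bound (x := -x) (by rwa [abs_neg]) (n := 4) (by norm_num))).2
  have h4 : |x| ^ 4 = x ^ 4 := by rw [← abs_pow, abs_of_nonneg (by positivity)]
  simp [Finset.sum_range_succ, Nat.factorial, h4] at h1 h2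
  have hs1 : x ^ 2 ≤ 1 := by
    rw [← sq_abs]; exact pow_le_one₀ (abs_nonneg _) hx
  have hs0 := sq_nonneg x
  have h3 := Real.quadratic_le_exp_of_nonneg (x := x ^ 2 / 2 - x ^ 4 / 48) (by nlinarith)
  rw [Real.cosh_eq]
  refine le_trans ?_ h3
  nlinarith [mul_nonneg (mul_nonneg hs0 hs0) (sub_nonneg.2 hs1), sq_nonneg (x ^ 4)]

theorem sinh_le_two_mul_abs {x : ℝ} (hx : |x| ≤ 1) : Real.sinh x ≤ 2 * |x| := by
  have h1 := (abs_le.1 (Real.abs_exp_sub_one_sub_id_le hx)).2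
  have h2 := (abs_le.1 (Real.abs_exp_sub_one_sub_id_le (x := -x) (by rwa [abs_neg]))).1
  rw [Real.sinh_eq]
  have h3 : x ^ 2 ≤ |x| := by
    rw [← sq_abs]; nlinarith [abs_nonneg x]
  nlinarith [le_abs_self x]

/-- The two-replica weight of a single site. -/
theorem two_replica_site_le {l : ℝ} (hl : |l| ≤ 1) (h : ℝ) :
    Real.exp (-h * 1 + -h * 1 + l * (1 * 1)) + Real.exp (-h * 1 + -h * -1 + l * (1 * -1))
      + (Real.exp (-h * -1 + -h * 1 + l * (-1 * 1)) + Real.exp (-h * -1 + -h * -1 + l * (-1 * -1)))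
      ≤ (2 * Real.cosh h) ^ 2 * Real.exp (l ^ 2 / 2 - l ^ 4 / 48 + 2 * |l| * Real.tanh h ^ 2) := by
  have hc := Real.cosh_pos h
  -- An exact identity: under the normalized field weights the product of the two spins has mean
  -- `tanh h ^ 2`.
  have e : Real.exp (-h * 1 + -h * 1 + l * (1 * 1)) + Real.exp (-h * 1 + -h * -1 + l * (1 * -1))
      + (Real.exp (-h * -1 + -h * 1 + l * (-1 * 1)) + Real.exp (-h * -1 + -h * -1 + l * (-1 * -1)))
      = (2 * Real.cosh h) ^ 2 * (Real.cosh l + Real.tanh h ^ 2 * Real.sinh l) := by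
    have e1 : (2 * Real.cosh h) ^ 2 * (Real.cosh l + Real.tanh h ^ 2 * Real.sinh l)
        = 4 * (Real.cosh h ^ 2 * Real.cosh l + Real.sinh h ^ 2 * Real.sinh l) := by
      rw [Real.tanh_eq_sinh_div_cosh]; field_simp; ring
    rw [e1, Real.cosh_eq, Real.cosh_eq, Real.sinh_eq, Real.sinh_eq]
    ring_nf
    simp only [← Real.exp_nat_mul, ← Real.exp_add]
    ring_nf
  rw [e]
  refine mul_le_mul_of_nonneg_left ?_ (by positivity)
  have h1 : Real.cosh l + Real.tanh h ^ 2 * Real.sinh l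
      ≤ Real.cosh l * (1 + 2 * |l| * Real.tanh h ^ 2) := by
    have h2 := sinh_le_two_mul_abs hl
    have h3 := Real.one_le_cosh l
    have h4 : 2 * |l| ≤ Real.cosh l * (2 * |l|) := le_mul_of_one_le_left (by positivity) h3
    nlinarith [sq_nonneg (Real.tanh h)]
  refine h1.trans ?_
  rw [Real.exp_add]
  refine mul_le_mul (cosh_le_exp_of_abs_le_one hl) ?_ (by positivity) (Real.exp_pos _).le
  linarith [Real.add_one_le_exp (2 * |l| * Real.tanh h ^ 2)]

theorem sum_two_replica_le (h : Fin N → ℝ) {l : ℝ} (hl : |l| ≤ 1) :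
    ∑ σ : Config N, ∑ τ : Config N, Real.exp (fieldWeight h σ + fieldWeight h τ
        + l * ∑ a, spin τ a * spin σ a)
      ≤ (∑ σ : Config N, Real.exp (fieldWeight h σ)) ^ 2 * Real.exp (N * (l ^ 2 / 2 - l ^ 4 / 48)
        + 2 * |l| * ∑ a, Real.tanh (h a) ^ 2) := by
  have h1 : ∀ σ τ : Config N, Real.exp (fieldWeight h σ + fieldWeight h τ
      + l * ∑ a, spin τ a * spin σ a)
      = ∏ a, Real.exp (-h a * spin σ a + -h a * spin τ a + l * (spin σ a * spin τ a)) := by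
    intro σ τ
    rw [← Real.exp_sum]
    simp only [fieldWeight, Finset.sum_add_distrib, Finset.mul_sum, neg_mul,
      Finset.sum_neg_distrib]
    congr 2
    exact Finset.sum_congr rfl fun a _ => by ring
  simp_rw [h1]
  have h2 : ∀ σ : Config N, ∑ τ : Config N,
      ∏ a, Real.exp (-h a * spin σ a + -h a * spin τ a + l * (spin σ a * spin τ a))
      = ∏ a, (Real.exp (-h a * spin σ a + -h a * 1 + l * (spin σ a * 1))
        + Real.exp (-h a * spin σ a + -h a * -1 + l * (spin σ a * -1))) := fun σ =>
    sum_config_prod (fun a t => Real.exp (-h a * spin σ a + -h a * t + l * (spin σ a * t)))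
  simp_rw [h2]
  rw [sum_config_prod (fun a s => Real.exp (-h a * s + -h a * 1 + l * (s * 1))
        + Real.exp (-h a * s + -h a * -1 + l * (s * -1))), sum_exp_fieldWeight, ← Finset.prod_pow]
  have h3 : Real.exp (N * (l ^ 2 / 2 - l ^ 4 / 48) + 2 * |l| * ∑ a, Real.tanh (h a) ^ 2)
      = ∏ a : Fin N, Real.exp (l ^ 2 / 2 - l ^ 4 / 48 + 2 * |l| * Real.tanh (h a) ^ 2) := by
    rw [← Real.exp_sum, Finset.sum_add_distrib, Finset.mul_sum]
    simp only [Finset.sum_const, Finset.card_univ, Fintype.card_fin, nsmul_eq_mul]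
  rw [h3, ← Finset.prod_mul_distrib]
  exact Finset.prod_le_prod (fun a _ => by positivity) fun a _ => two_replica_site_le hl (h a)

/-- A discrete Hubbard–Stratonovich linearization. The overlap sum is an integer in `[-N, N]`, so
the term with `j` equal to it is already the left side. The price is a factor of at most `2 * N +
1`, harmless on the exponential scale even at criticality. -/
theorem exp_overlap_sq_le (hN : 0 < N) (σ τ : Config N) :
    Real.exp ((∑ a, spin τ a * spin σ a) ^ 2 / (2 * N))
      ≤ ∑ j ∈ Finset.Icc (-N : ℤ) N, Real.exp (j / N * (∑ a, spin τ a * spin σ a)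
        - j ^ 2 / (2 * N)) := by
  set k : ℤ := ∑ a, (τ a : ℤ) * (σ a : ℤ) with hk
  have hkR : ∑ a, spin τ a * spin σ a = (k : ℝ) := by
    rw [hk]; push_cast; rfl
  have hkN : |(k : ℝ)| ≤ N := by
    rw [← hkR]
    refine (Finset.abs_sum_le_sum_abs _ _).trans ?_
    simp [abs_mul, abs_spin]
  have hkmem : k ∈ Finset.Icc (-N : ℤ) N := by
    rw [Finset.mem_Icc]
    have := abs_le.1 hkN
    exact ⟨by exact_mod_cast this.1, by exact_mod_cast this.2⟩
  rw [hkR]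
  refine le_trans (le_of_eq ?_) (Finset.single_le_sum
    (f := fun j : ℤ => Real.exp (j / N * (k : ℝ) - j ^ 2 / (2 * N)))
    (fun _ _ => (Real.exp_pos _).le) hkmem)
  have : (N : ℝ) ≠ 0 := by positivity
  congr 1
  field_simp
  ring

/-- After linearization the sites decouple. For `l = j / N` the Gaussian factor `exp (-N l ^ 2 / 2)`
cancels the quadratic term, and what is left is the exponent `-N l ^ 4 / 48 + 2 |l| Q` with `Q = ∑
tanh ^ 2`. -/
theorem integral_expSum_sq_le (hN : 0 < N) {c : ℝ} (hc : c ^ 2 ≤ 1 / 2) (h : Fin N → ℝ) {ε : ℝ}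
    (hε : 0 ≤ ε) (hQ : 2 * ∑ a, Real.tanh (h a) ^ 2 ≤ N * (ε ^ 3 / 48)) :
    ∫ x, expSum (fieldWeight h) (fun σ p => -c * coef σ p) x ^ 2 ∂stdGaussian (Fin N × Fin N)
      ≤ ((2 * N + 1) * Real.exp (2 * ε * ∑ a, Real.tanh (h a) ^ 2))
        * (∫ x, expSum (fieldWeight h) (fun σ p => -c * coef σ p) x
          ∂stdGaussian (Fin N × Fin N)) ^ 2 := by
  set Q := ∑ a, Real.tanh (h a) ^ 2 with hQdef
  have hQ0 : 0 ≤ Q := Finset.sum_nonneg fun _ _ => sq_nonneg _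
  set T := ∑ σ : Config N, Real.exp (fieldWeight h σ) with hT
  have hN' : (0 : ℝ) < N := by exact_mod_cast hN
  rw [integral_expSum_sq, integral_expSum_coef, mul_pow, ← Real.exp_nat_mul]
  have h1 : ∀ σ τ : Config N, Real.exp (fieldWeight h σ + fieldWeight h τ
      + (∑ p, (-c * coef σ p + -c * coef τ p) ^ 2) / 2)
      ≤ Real.exp (c ^ 2 * N) * ∑ j ∈ Finset.Icc (-N : ℤ) N, Real.exp (-(j ^ 2 / (2 * N)))
        * Real.exp (fieldWeight h σ + fieldWeight h τ + j / N * ∑ a, spin τ a * spin σ a) := by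
    intro σ τ
    set R := ∑ a, spin τ a * spin σ a with hR
    have e1 : (∑ p, (-c * coef σ p + -c * coef τ p) ^ 2) / 2 = c ^ 2 * N + c ^ 2 * (R ^ 2 / N) := by
      have : ∀ p, (-c * coef σ p + -c * coef τ p) ^ 2
          = c ^ 2 * (coef σ p ^ 2 + coef τ p ^ 2 + 2 * (coef σ p * coef τ p)) := fun p => by ring
      simp_rw [this, ← Finset.mul_sum, Finset.sum_add_distrib, ← Finset.mul_sum,
        sum_coef_sq, sum_coef_mul_coef]
      ring
    have e2 : c ^ 2 * (R ^ 2 / N) ≤ R ^ 2 / (2 * N) := by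
      calc c ^ 2 * (R ^ 2 / N) ≤ 1 / 2 * (R ^ 2 / N) :=
            mul_le_mul_of_nonneg_right hc (by positivity)
        _ = R ^ 2 / (2 * N) := by field_simp
    have e3 := exp_overlap_sq_le hN σ τ
    calc _ ≤ Real.exp (c ^ 2 * N + (fieldWeight h σ + fieldWeight h τ) + R ^ 2 / (2 * N)) := by
          rw [e1]; refine Real.exp_le_exp.2 ?_; linarith
      _ = Real.exp (c ^ 2 * N) * (Real.exp (fieldWeight h σ + fieldWeight h τ)
            * Real.exp (R ^ 2 / (2 * N))) := by rw [Real.exp_add, Real.exp_add, mul_assoc]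
      _ ≤ Real.exp (c ^ 2 * N) * (Real.exp (fieldWeight h σ + fieldWeight h τ)
            * ∑ j ∈ Finset.Icc (-N : ℤ) N, Real.exp (j / N * R - j ^ 2 / (2 * N))) := by
          gcongr
      _ = _ := by
          rw [Finset.mul_sum]
          congr 1
          refine Finset.sum_congr rfl fun j _ => ?_
          rw [← Real.exp_add, ← Real.exp_add]
          congr 1
          ring
  have h2 : ∀ j ∈ Finset.Icc (-N : ℤ) N, Real.exp (-(j ^ 2 / (2 * N)))
      * ∑ σ : Config N, ∑ τ : Config N, Real.exp (fieldWeight h σ + fieldWeight h τ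
        + j / N * ∑ a, spin τ a * spin σ a) ≤ T ^ 2 * Real.exp (2 * ε * Q) := by
    intro j hj
    rw [Finset.mem_Icc] at hj
    have hj1 : |(j : ℝ)| ≤ N := abs_le.2 ⟨by exact_mod_cast hj.1, by exact_mod_cast hj.2⟩
    set l : ℝ := j / N with hl
    have hl1 : |l| ≤ 1 := by
      rw [hl, abs_div, abs_of_pos hN', div_le_one hN']; exact hj1
    refine (mul_le_mul_of_nonneg_left (sum_two_replica_le h hl1) (Real.exp_pos _).le).trans ?_
    rw [mul_left_comm, ← Real.exp_add]
    refine mul_le_mul_of_nonneg_left (Real.exp_le_exp.2 ?_) (sq_nonneg _)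
    have e1 : (j : ℝ) ^ 2 / (2 * N) = N * (l ^ 2 / 2) := by rw [hl]; field_simp
    have e2 : l ^ 4 = |l| ^ 4 := by rw [← abs_pow, abs_of_nonneg (by positivity)]
    rw [e1, e2, ← hQdef]
    -- For `|l| ≤ ε` the field term is at most `2 ε Q`; for `|l| > ε` the assumption on `Q` makes
    -- the quartic term dominate, and the exponent is nonpositive.
    rcases le_or_gt |l| ε with h3 | h3
    · have : 0 ≤ (N : ℝ) * |l| ^ 4 := by positivity
      nlinarith
    · have h4 : ε ^ 3 ≤ |l| ^ 3 := pow_le_pow_left₀ hε h3.le 3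
      have h5 : 2 * Q ≤ N * (|l| ^ 3 / 48) := hQ.trans (by gcongr)
      have h6 := mul_le_mul_of_nonneg_left h5 (abs_nonneg l)
      have h7 : 0 ≤ 2 * ε * Q := by positivity
      nlinarith
  calc _ ≤ ∑ σ : Config N, ∑ τ : Config N, Real.exp (c ^ 2 * N) * ∑ j ∈ Finset.Icc (-N : ℤ) N,
        Real.exp (-(j ^ 2 / (2 * N)))
        * Real.exp (fieldWeight h σ + fieldWeight h τ + j / N * ∑ a, spin τ a * spin σ a) :=
        Finset.sum_le_sum fun σ _ => Finset.sum_le_sum fun τ _ => h1 σ τ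
    _ = Real.exp (c ^ 2 * N) * ∑ j ∈ Finset.Icc (-N : ℤ) N, Real.exp (-(j ^ 2 / (2 * N)))
        * ∑ σ : Config N, ∑ τ : Config N, Real.exp (fieldWeight h σ + fieldWeight h τ
          + j / N * ∑ a, spin τ a * spin σ a) := by
        simp_rw [← Finset.mul_sum]
        congr 1
        simp_rw [Finset.sum_comm (t := Finset.Icc (-N : ℤ) N)]
        simp_rw [Finset.mul_sum]
    _ ≤ Real.exp (c ^ 2 * N) * ∑ j ∈ Finset.Icc (-N : ℤ) N, T ^ 2 * Real.exp (2 * ε * Q) := by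
        exact mul_le_mul_of_nonneg_left (Finset.sum_le_sum h2) (Real.exp_pos _).le
    _ = _ := by
        rw [Finset.sum_const, Int.card_Icc, nsmul_eq_mul]
        have : ((((N : ℤ) + 1 - -(N : ℤ)).toNat : ℕ) : ℝ) = 2 * N + 1 := by
          rw [show ((N : ℤ) + 1 - -(N : ℤ)).toNat = 2 * N + 1 by omega]
          push_cast; ring
        rw [this]
        have e : Real.exp (c ^ 2 * N) = Real.exp ((2 : ℕ) * (c ^ 2 * N / 2)) := by
          congr 1; push_cast; ring
        rw [e]
        ring

/-- At high temperature the fractional moments agree with the first moment to leading order, if the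
external field is small. -/
theorem le_log_moment (hN : 0 < N) {c : ℝ} (hc : c ^ 2 ≤ 1 / 2) (h : Fin N → ℝ) {ε m : ℝ}
    (hm : 0 ≤ m) (hm1 : m ≤ 1)
    (hε : 0 ≤ ε) (hQ : 2 * ∑ a, Real.tanh (h a) ^ 2 ≤ N * (ε ^ 3 / 48)) :
    m * (N * (Real.log 2 + c ^ 2 / 2) + ∑ a, Real.log (Real.cosh (h a)))
      - Real.log (4 * (2 * N + 1)) - 2 * ε * ∑ a, Real.tanh (h a) ^ 2
      ≤ Real.log (moment m c (fieldWeight h)) := by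
  have hQ0 : 0 ≤ ∑ a, Real.tanh (h a) ^ 2 := Finset.sum_nonneg fun _ _ => sq_nonneg _
  have hN' : (0 : ℝ) < N := by exact_mod_cast hN
  have hC : 1 ≤ (2 * N + 1) * Real.exp (2 * ε * ∑ a, Real.tanh (h a) ^ 2) := by
    have := Real.one_le_exp (x := 2 * ε * ∑ a, Real.tanh (h a) ^ 2) (by positivity)
    nlinarith
  have key := rpow_integral_expSum_le (fieldWeight h) (fun σ p => -c * coef σ p) hm hm1 hC
    (integral_expSum_sq_le hN hc h hε hQ)
  rw [integral_expSum_coef, sum_exp_fieldWeight] at key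
  have hP : 0 < ∏ a, (2 * Real.cosh (h a)) :=
    Finset.prod_pos fun a _ => by have := Real.cosh_pos (h a); positivity
  have h1 := Real.log_le_log (by positivity) key
  rw [Real.log_div (by positivity) (by positivity), Real.log_rpow (by positivity),
    Real.log_mul (Real.exp_pos _).ne' hP.ne', Real.log_exp,
    Real.log_prod (fun a _ => by have := Real.cosh_pos (h a); positivity),
    ← mul_assoc, Real.log_mul (by positivity) (Real.exp_pos _).ne', Real.log_exp] at h1
  have h2 : ∑ a, Real.log (2 * Real.cosh (h a))
      = N * Real.log 2 + ∑ a, Real.log (Real.cosh (h a)) := by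
    simp_rw [fun a => Real.log_mul two_ne_zero (Real.cosh_pos (h a)).ne']
    rw [Finset.sum_add_distrib]
    simp
  rw [h2] at h1
  refine le_trans (le_of_eq ?_) h1
  ring

end Spins

/-! ### Change of measure for fractional moments -/

section Tilting

variable {S ι : Type*} [Fintype S] [Fintype ι]

/-- A change of measure bounds a fractional moment by the mean of the tilted partition function. -/
theorem integral_expSum_rpow_le_tilt [Nonempty S] (u : S → ℝ) (α : S → ι → ℝ) (l : ι → ℝ) {m : ℝ}
    (hm : 0 < m) (hm1 : m < 1) :
    ∫ x, expSum u α x ^ m ∂stdGaussian ι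
      ≤ (∫ x, expSum u (fun σ k => α σ k + l k) x ∂stdGaussian ι) ^ m
        * Real.exp (m ^ 2 / (1 - m) * ((∑ k, l k ^ 2) / 2)) := by
  have hm' : 0 < 1 - m := sub_pos.2 hm1
  set W := expSum u (fun σ k => α σ k + l k) with hW
  have hWpos : ∀ x, 0 < W x := expSum_pos _ _
  set P := ∫ x, W x ∂stdGaussian ι with hP
  have hPpos : 0 < P := by
    rw [hP, hW, integral_expSum]
    exact Finset.sum_pos (fun _ _ => Real.exp_pos _) Finset.univ_nonempty
  -- The exponent makes `v ^ (1 - m)` undo the tilt in `W ^ m`, so that `Z ^ m = W ^ m * v ^ (1 -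
  -- m)`.
  set v : (ι → ℝ) → ℝ := fun x => Real.exp (∑ k, (-(m / (1 - m)) * l k) * x k) with hv
  set Q := ∫ x, v x ∂stdGaussian ι with hQ
  have hQval : Q = Real.exp (m ^ 2 / (1 - m) ^ 2 * ((∑ k, l k ^ 2) / 2)) := by
    rw [hQ, hv, integral_exp_sum_mul]
    simp_rw [mul_pow, ← Finset.mul_sum]
    congr 1
    rw [neg_sq, div_pow, mul_div_assoc]
  have hQpos : 0 < Q := by rw [hQval]; exact Real.exp_pos _
  -- Hölder's inequality in pointwise form: weighted AM-GM after normalizing `W` and `v` by their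
  -- means.
  have hpt : ∀ x, expSum u α x ^ m
      ≤ P ^ m * Q ^ (1 - m) * (m * (W x / P) + (1 - m) * (v x / Q)) := by
    intro x
    have h1 : expSum u α x = W x * Real.exp (-∑ k, l k * x k) := by
      rw [hW, expSum, expSum, Finset.sum_mul]
      refine Finset.sum_congr rfl fun σ _ => ?_
      rw [← Real.exp_add]
      simp_rw [add_mul, Finset.sum_add_distrib]
      congr 1
      ring
    have h2 : v x ^ (1 - m) = Real.exp (-∑ k, l k * x k) ^ m := by
      rw [hv, ← Real.exp_mul, ← Real.exp_mul, ← Finset.sum_neg_distrib, Finset.sum_mul,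
        Finset.sum_mul]
      congr 1
      refine Finset.sum_congr rfl fun k _ => ?_
      field_simp
    have h3 := Real.geom_mean_le_arith_mean2_weighted hm.le hm'.le
      (div_pos (hWpos x) hPpos).le (div_pos (Real.exp_pos _ : 0 < v x) hQpos).le (by ring)
    rw [Real.div_rpow (hWpos x).le hPpos.le, Real.div_rpow (Real.exp_pos _).le hQpos.le] at h3
    have hPm := Real.rpow_pos_of_pos hPpos m
    have hQm := Real.rpow_pos_of_pos hQpos (1 - m)
    calc expSum u α x ^ m = W x ^ m * v x ^ (1 - m) := by
          rw [h1, Real.mul_rpow (hWpos x).le (Real.exp_pos _).le, h2]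
      _ = P ^ m * Q ^ (1 - m) * (W x ^ m / P ^ m * (v x ^ (1 - m) / Q ^ (1 - m))) := by
          field_simp
      _ ≤ _ := mul_le_mul_of_nonneg_left h3 (by positivity)
  have hvi : Integrable v (stdGaussian ι) := integrable_exp_sum_mul _
  have hWi : Integrable W (stdGaussian ι) := integrable_expSum _ _
  have h4 := integral_mono (integrable_expSum_rpow u α hm.le)
    ((((hWi.div_const P).const_mul m).add ((hvi.div_const Q).const_mul (1 - m))).const_mul
      (P ^ m * Q ^ (1 - m))) hpt
  refine h4.trans (le_of_eq ?_)
  rw [integral_const_mul]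
  simp only [Pi.add_apply]
  rw [integral_add ((hWi.div_const P).const_mul m) ((hvi.div_const Q).const_mul (1 - m)),
    integral_const_mul, integral_const_mul, integral_div, integral_div, ← hP, ← hQ,
    div_self hPpos.ne', div_self hQpos.ne', mul_one, mul_one, add_sub_cancel, mul_one, hQval,
    ← Real.exp_mul]
  congr 2
  field_simp

end Tilting

/-! ### Effect of the field: monotonicity and the strict annealed bound -/

section Field

variable {N : ℕ}

theorem energy_neg (x : Couplings N) (σ : Config N) : energy x (-σ) = energy x σ := by
  simp [energy, coef, spin]

theorem fieldWeight_neg (h : Fin N → ℝ) (σ : Config N) :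
    fieldWeight h (-σ) = -fieldWeight h σ := by
  simp [fieldWeight, spin]

theorem fieldWeight_smul (s : ℝ) (h : Fin N → ℝ) (σ : Config N) :
    fieldWeight (s • h) σ = s * fieldWeight h σ := by
  simp [fieldWeight, Finset.mul_sum, mul_assoc]

/-- The energy is even under a global spin flip, so averaging `σ` with `-σ` leaves a `cosh`, which
is visibly monotone in the field strength. -/
theorem expSum_fieldWeight_eq (c : ℝ) (h : Fin N → ℝ) (x : Couplings N) :
    expSum (fieldWeight h) (fun σ p => -c * coef σ p) x
      = ∑ σ, Real.exp (-c * energy x σ) * Real.cosh (fieldWeight h σ) := by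
  rw [expSum_coef]
  have h1 : ∑ σ, Real.exp (fieldWeight h σ - c * energy x σ)
      = ∑ σ, Real.exp (-fieldWeight h σ - c * energy x σ) := by
    rw [← Equiv.sum_comp (Equiv.neg (Config N))]
    simp [energy_neg, fieldWeight_neg]
  have h2 : ∑ σ, Real.exp (-c * energy x σ) * Real.cosh (fieldWeight h σ)
      = (∑ σ, Real.exp (fieldWeight h σ - c * energy x σ)
        + ∑ σ, Real.exp (-fieldWeight h σ - c * energy x σ)) / 2 := by
    rw [← Finset.sum_add_distrib, Finset.sum_div]
    refine Finset.sum_congr rfl fun σ _ => ?_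
    rw [Real.cosh_eq, sub_eq_add_neg, sub_eq_add_neg, Real.exp_add, Real.exp_add, neg_mul]
    ring
  rw [h2, ← h1]
  ring

/-- Moments are monotone in the strength of the field. -/
theorem moment_fieldWeight_smul_le {m : ℝ} (hm : 0 ≤ m) (c : ℝ) (h : Fin N → ℝ) {s : ℝ}
    (hs : 0 ≤ s) (hs1 : s ≤ 1) : moment m c (fieldWeight (s • h)) ≤ moment m c (fieldWeight h) := by
  refine integral_mono (integrable_expSum_rpow _ _ hm) (integrable_expSum_rpow _ _ hm) fun x => ?_
  refine Real.rpow_le_rpow (expSum_pos _ _ _).le ?_ hm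
  rw [expSum_fieldWeight_eq, expSum_fieldWeight_eq]
  refine Finset.sum_le_sum fun σ _ => mul_le_mul_of_nonneg_left ?_ (Real.exp_pos _).le
  rw [fieldWeight_smul, Real.cosh_le_cosh, abs_mul, abs_of_nonneg hs]
  exact mul_le_of_le_one_left (abs_nonneg _) hs1

/-- The ratio `cosh (h - y) / cosh h` is the mean of `exp (± y)` under weights `(1 ∓ tanh h) / 2`;
then `exp y ≤ 1 + y + y ^ 2` on `[-1, 1]` is averaged. -/
theorem cosh_sub_le (h : ℝ) {y : ℝ} (hy : |y| ≤ 1) :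
    Real.cosh (h - y) ≤ Real.cosh h * Real.exp (-y * Real.tanh h + y ^ 2) := by
  have hc := Real.cosh_pos h
  have h1 := (abs_le.1 (Real.abs_exp_sub_one_sub_id_le hy)).2
  have h2 := (abs_le.1 (Real.abs_exp_sub_one_sub_id_le (x := -y) (by rwa [abs_neg]))).2
  have h3 : Real.cosh (h - y) = Real.cosh h * ((1 - Real.tanh h) / 2 * Real.exp y
      + (1 + Real.tanh h) / 2 * Real.exp (-y)) := by
    rw [Real.cosh_sub, Real.tanh_eq_sinh_div_cosh, Real.cosh_eq y, Real.sinh_eq y]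
    field_simp
    ring
  rw [h3]
  refine mul_le_mul_of_nonneg_left ?_ hc.le
  have ht1 := Real.tanh_lt_one h
  have ht2 := Real.neg_one_lt_tanh h
  refine le_trans ?_ (Real.add_one_le_exp _)
  nlinarith [mul_le_mul_of_nonneg_left h1 (by linarith : 0 ≤ (1 - Real.tanh h) / 2),
    mul_le_mul_of_nonneg_left h2 (by linarith : 0 ≤ (1 + Real.tanh h) / 2)]

theorem sq_tanh_le_one (x : ℝ) : Real.tanh x ^ 2 ≤ 1 := by
  nlinarith [Real.tanh_lt_one x, Real.neg_one_lt_tanh x]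

/-- In a field, fractional moments are smaller than the annealed value. -/
theorem log_moment_le (hN : 0 < N) {c m a l : ℝ} (hm : 0 < m) (hm1 : m < 1) (hc : 0 ≤ c)
    (ha : 0 ≤ a) (ha1 : a ≤ 1) (hl : 0 ≤ l) (hcl : 2 * c * l ≤ 1) (h : Fin N → ℝ) :
    Real.log (moment m c (fieldWeight h)) ≤ m * (N * (Real.log 2 + c ^ 2 / 2)
      + ∑ i, Real.log (Real.cosh (h i))
      + N * (c * l * a ^ 2 + l ^ 2 * (1 / (2 * (1 - m)) + 4 * c ^ 2))
      - 2 * a * c * l * ∑ i, Real.tanh (h i) ^ 2) := by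
  have hN' : (0 : ℝ) < N := by exact_mod_cast hN
  have hm' : 0 < 1 - m := sub_pos.2 hm1
  set t : Fin N → ℝ := fun i => Real.tanh (h i) with ht
  set Q := ∑ i, t i ^ 2 with hQ
  have hQN : Q ≤ N := by
    refine (Finset.sum_le_sum fun i _ => sq_tanh_le_one (h i)).trans ?_
    simp
  have hQ0 : 0 ≤ Q := Finset.sum_nonneg fun _ _ => sq_nonneg _
  -- The tilt points along `tanh h ⊗ tanh h`. Its cross term with the energy is `-c l R ^ 2 / N`
  -- with `R = ∑ tanh (h i) σ_i`, which is negative of order `N` when the spins follow the field.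
  set ell : Fin N × Fin N → ℝ := fun p => l * (t p.1 * t p.2 / √(N : ℝ)) with hell
  have hV : ∑ p, ell p ^ 2 ≤ l ^ 2 * N := by
    have : ∀ p, ell p ^ 2 ≤ l ^ 2 / N := fun p => by
      simp only [hell, mul_pow, div_pow, Real.sq_sqrt hN'.le]
      rw [← mul_div_assoc]
      gcongr
      exact mul_le_of_le_one_right (sq_nonneg _)
        (mul_le_one₀ (sq_tanh_le_one _) (sq_nonneg _) (sq_tanh_le_one _))
    refine (Finset.sum_le_sum fun p _ => this p).trans (le_of_eq ?_)
    simp only [Finset.sum_const, Finset.card_univ, Fintype.card_prod, Fintype.card_fin,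
      nsmul_eq_mul, Nat.cast_mul]
    field_simp
  have htilt := integral_expSum_rpow_le_tilt (fieldWeight h) (fun σ p => -c * coef σ p) ell hm hm1
  set y : Fin N → ℝ := fun i => 2 * a * c * l * t i with hy
  have hPle : ∫ x, expSum (fieldWeight h) (fun σ p => -c * coef σ p + ell p) x
        ∂stdGaussian (Fin N × Fin N)
      ≤ Real.exp (N * (c ^ 2 / 2 + l ^ 2 / 2 + c * l * a ^ 2))
        * ∏ i, (2 * (Real.cosh (h i) * Real.exp (-y i * t i + y i ^ 2))) := by
    rw [integral_expSum]
    have h1 : ∀ σ : Config N, Real.exp (fieldWeight h σ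
        + (∑ p, (-c * coef σ p + ell p) ^ 2) / 2)
        ≤ Real.exp (N * (c ^ 2 / 2 + l ^ 2 / 2 + c * l * a ^ 2))
          * Real.exp (∑ i, (-(h i - y i)) * spin σ i) := by
      intro σ
      rw [← Real.exp_add]
      refine Real.exp_le_exp.2 ?_
      set R := ∑ i, t i * spin σ i with hR
      have e1 : ∑ p, (-c * coef σ p + ell p) ^ 2
          = c ^ 2 * N - 2 * c * l * (R ^ 2 / N) + ∑ p, ell p ^ 2 := by
        have : ∀ p, (-c * coef σ p + ell p) ^ 2 = c ^ 2 * coef σ p ^ 2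
            - 2 * c * l * (coef σ p * (t p.1 * t p.2 / √(N : ℝ))) + ell p ^ 2 := fun p => by
          simp only [hell]; ring
        simp_rw [this, Finset.sum_add_distrib, Finset.sum_sub_distrib, ← Finset.mul_sum,
          sum_coef_sq, sum_coef_mul]
        rfl
      have e2 : ∑ i, (-(h i - y i)) * spin σ i = fieldWeight h σ + 2 * a * c * l * R := by
        simp only [fieldWeight, hR, hy, Finset.mul_sum, ← Finset.sum_neg_distrib,
          ← Finset.sum_add_distrib]
        exact Finset.sum_congr rfl fun i _ => by ring
      -- The square is linearized about `R = -a N`, since the weights `exp (-h σ)` give each spin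
      -- the mean `-tanh h`. The linear term in `R` then shifts the field `h` by `y`.
      have e3 : -(2 * a * R) - a ^ 2 * N ≤ R ^ 2 / N := by
        rw [le_div_iff₀ hN']
        nlinarith [sq_nonneg (R + a * N)]
      have e4 := mul_le_mul_of_nonneg_left e3 (mul_nonneg hc hl)
      rw [e1, e2]
      nlinarith
    refine (Finset.sum_le_sum fun σ _ => h1 σ).trans ?_
    rw [← Finset.mul_sum, sum_config_exp]
    refine mul_le_mul_of_nonneg_left ?_ (Real.exp_pos _).le
    refine Finset.prod_le_prod (fun i _ => by positivity) fun i _ => ?_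
    rw [Real.cosh_neg]
    refine mul_le_mul_of_nonneg_left (cosh_sub_le (h i) ?_) zero_le_two
    have ht1 : |t i| ≤ 1 :=
      abs_le.2 ⟨(Real.neg_one_lt_tanh (h i)).le, (Real.tanh_lt_one (h i)).le⟩
    have h0 : 0 ≤ 2 * a * c * l := by positivity
    rw [hy, abs_mul, abs_of_nonneg h0]
    refine mul_le_one₀ ?_ (abs_nonneg _) ht1
    nlinarith [mul_nonneg hc hl]
  have hP0 : 0 < ∫ x, expSum (fieldWeight h) (fun σ p => -c * coef σ p + ell p) x
        ∂stdGaussian (Fin N × Fin N) := by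
    rw [integral_expSum]
    exact Finset.sum_pos (fun _ _ => Real.exp_pos _) Finset.univ_nonempty
  have hlogP := Real.log_le_log hP0 hPle
  have hci : ∀ i, 0 < 2 * (Real.cosh (h i) * Real.exp (-y i * t i + y i ^ 2)) := fun i => by
    have := Real.cosh_pos (h i); positivity
  rw [Real.log_mul (Real.exp_pos _).ne' (Finset.prod_pos fun i _ => hci i).ne', Real.log_exp,
    Real.log_prod fun i _ => (hci i).ne'] at hlogP
  have hsum : ∑ i, Real.log (2 * (Real.cosh (h i) * Real.exp (-y i * t i + y i ^ 2)))
      = N * Real.log 2 + ∑ i, Real.log (Real.cosh (h i))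
        + (-(2 * a * c * l) + (2 * a * c * l) ^ 2) * Q := by
    have : ∀ i, Real.log (2 * (Real.cosh (h i) * Real.exp (-y i * t i + y i ^ 2)))
        = Real.log 2 + Real.log (Real.cosh (h i))
          + (-(2 * a * c * l) + (2 * a * c * l) ^ 2) * t i ^ 2 := fun i => by
      rw [Real.log_mul two_ne_zero (by have := Real.cosh_pos (h i); positivity),
        Real.log_mul (Real.cosh_pos _).ne' (Real.exp_pos _).ne', Real.log_exp]
      simp only [hy]; ring
    simp_rw [this, Finset.sum_add_distrib, ← Finset.mul_sum]
    simp only [Finset.sum_const, Finset.card_univ, Fintype.card_fin, nsmul_eq_mul]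
    rfl
  rw [hsum] at hlogP
  have hmom := Real.log_le_log (moment_pos m c hm.le (fieldWeight h)) htilt
  rw [Real.log_mul (Real.rpow_pos_of_pos hP0 m).ne' (Real.exp_pos _).ne', Real.log_exp,
    Real.log_rpow hP0] at hmom
  refine hmom.trans ?_
  have h5 : m ^ 2 / (1 - m) * ((∑ p, ell p ^ 2) / 2) ≤ m * (N * (l ^ 2 * (m / (2 * (1 - m))))) := by
    calc m ^ 2 / (1 - m) * ((∑ p, ell p ^ 2) / 2)
        ≤ m ^ 2 / (1 - m) * (l ^ 2 * N / 2) := by gcongr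
      _ = _ := by field_simp
  have h6 := mul_le_mul_of_nonneg_left hlogP hm.le
  have h7 : (2 * a * c * l) ^ 2 * Q ≤ N * (l ^ 2 * (4 * c ^ 2)) := by
    have : a ^ 2 * Q ≤ 1 * N := mul_le_mul (pow_le_one₀ ha ha1) hQN hQ0 zero_le_one
    nlinarith [mul_le_mul_of_nonneg_left this (by positivity : 0 ≤ 4 * c ^ 2 * l ^ 2)]
  -- The cost `m / (2 * (1 - m))` of the change of measure joins the `1/2` from the variance of the
  -- tilt.
  have h8 : 1 / (2 * (1 - m)) = m / (2 * (1 - m)) + 1 / 2 := by field_simp; ring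
  rw [h8]
  have h9 := mul_le_mul_of_nonneg_left h7 hm.le
  nlinarith

end Field

/-! ### One-site expansion of the replica symmetric bound -/

section OneDimensional

theorem nonneg_of_hasDerivAt_nonneg {f f' : ℝ → ℝ} (hf : ∀ x, 0 ≤ x → HasDerivAt f (f' x) x)
    (hf' : ∀ x, 0 ≤ x → 0 ≤ f' x) (h0 : 0 ≤ f 0) {x : ℝ} (hx : 0 ≤ x) : 0 ≤ f x := by
  have hmono : MonotoneOn f (Set.Ici 0) := by
    refine monotoneOn_of_deriv_nonneg (convex_Ici 0)
      (fun y hy => (hf y hy).continuousAt.continuousWithinAt)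
      (fun y hy => ?_) fun y hy => ?_
    · rw [interior_Ici] at hy
      exact (hf y hy.le).differentiableAt.differentiableWithinAt
    · rw [interior_Ici] at hy
      rw [(hf y hy.le).deriv]
      exact hf' y hy.le
  exact h0.trans (hmono Set.self_mem_Ici hx hx)

theorem hasDerivAt_one_add_rpow (r : ℝ) {x : ℝ} (hx : 0 ≤ x) :
    HasDerivAt (fun x : ℝ => (1 + x) ^ r) (r * (1 + x) ^ (r - 1)) x := by
  refine (((hasDerivAt_id x).const_add 1).rpow_const (p := r)
    (Or.inl (by simp only [id]; positivity))).congr_deriv ?_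
  simp

/-- Taylor's bound obtained by integrating a linear estimate of `(1 + x) ^ (m - 2)` twice. The
coefficient `1` of the cubic term generously replaces `m (1 - m) (2 - m) / 6`. -/
theorem one_add_rpow_le_cubic {m x : ℝ} (hm : 0 ≤ m) (hm1 : m ≤ 1) (hx : 0 ≤ x) :
    (1 + x) ^ m ≤ 1 + m * x - m * (1 - m) / 2 * x ^ 2 + x ^ 3 := by
  have h1 : ∀ x : ℝ, 0 ≤ x → 0 ≤ (1 + x) ^ (m - 2) - (1 + (m - 2) * x) := fun x hx => by
    refine nonneg_of_hasDerivAt_nonneg (f := fun x => (1 + x) ^ (m - 2) - (1 + (m - 2) * x))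
      (f' := fun x => (m - 2) * (1 + x) ^ (m - 2 - 1) - (m - 2)) (fun y hy => ?_) (fun y hy => ?_)
      (by simp) hx
    · refine ((hasDerivAt_one_add_rpow _ hy).sub
        (((hasDerivAt_id y).const_mul (m - 2)).const_add 1)).congr_deriv ?_
      simp
    · have : (1 + y) ^ (m - 2 - 1) ≤ 1 :=
        Real.rpow_le_one_of_one_le_of_nonpos (by linarith) (by linarith)
      nlinarith
  have h2 : ∀ x : ℝ, 0 ≤ x →
      0 ≤ 1 + (m - 1) * x + (m - 1) * (m - 2) / 2 * x ^ 2 - (1 + x) ^ (m - 1) := fun x hx => by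
    refine nonneg_of_hasDerivAt_nonneg
      (f := fun x => 1 + (m - 1) * x + (m - 1) * (m - 2) / 2 * x ^ 2 - (1 + x) ^ (m - 1))
      (f' := fun x => (m - 1) + (m - 1) * (m - 2) * x - (m - 1) * (1 + x) ^ (m - 2))
      (fun y hy => ?_) (fun y hy => ?_) (by simp) hx
    · refine (((((hasDerivAt_id y).const_mul (m - 1)).const_add 1).add
        (((hasDerivAt_id y).pow 2).const_mul ((m - 1) * (m - 2) / 2))).sub
        (hasDerivAt_one_add_rpow _ hy)).congr_deriv ?_
      rw [show m - 1 - 1 = m - 2 by ring]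
      simp only [id]; push_cast; ring
    · have := h1 y hy
      nlinarith
  suffices h : 0 ≤ 1 + m * x - m * (1 - m) / 2 * x ^ 2 + x ^ 3 - (1 + x) ^ m by linarith
  refine nonneg_of_hasDerivAt_nonneg
    (f := fun x => 1 + m * x - m * (1 - m) / 2 * x ^ 2 + x ^ 3 - (1 + x) ^ m)
    (f' := fun x => m - m * (1 - m) * x + 3 * x ^ 2 - m * (1 + x) ^ (m - 1))
    (fun y hy => ?_) (fun y hy => ?_) (by simp) hx
  · refine ((((((hasDerivAt_id y).const_mul m).const_add 1).sub
      (((hasDerivAt_id y).pow 2).const_mul (m * (1 - m) / 2))).add ((hasDerivAt_id y).pow 3)).sub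
      (hasDerivAt_one_add_rpow _ hy)).congr_deriv ?_
    simp only [id]; push_cast; ring
  · have h3 := mul_le_mul_of_nonneg_left (h2 y hy) hm
    have h4 : m * ((1 - m) * (2 - m) / 2) ≤ 3 := by nlinarith [mul_nonneg hm (sub_nonneg.2 hm1)]
    have h5 := mul_le_mul_of_nonneg_right h4 (sq_nonneg y)
    nlinarith

theorem integrable_cosh_gaussianReal (t : ℝ) :
    Integrable (fun z => Real.cosh (t * z)) (gaussianReal 0 1) := by
  simp_rw [Real.cosh_eq, ← neg_mul]
  exact ((integrable_exp_mul_gaussianReal t).add (integrable_exp_mul_gaussianReal (-t))).div_const 2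

theorem integral_cosh_gaussianReal (t : ℝ) :
    ∫ z, Real.cosh (t * z) ∂gaussianReal 0 1 = Real.exp (t ^ 2 / 2) := by
  simp_rw [Real.cosh_eq, ← neg_mul]
  rw [integral_div, integral_add (integrable_exp_mul_gaussianReal t)
    (integrable_exp_mul_gaussianReal (-t)), integral_exp_mul_gaussianReal,
    integral_exp_mul_gaussianReal, neg_sq]
  ring

theorem integrable_cosh_rpow_gaussianReal (s : ℝ) {m : ℝ} (hm1 : m ≤ 1) :
    Integrable (fun z => Real.cosh (s * z) ^ m) (gaussianReal 0 1) := by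
  refine (integrable_cosh_gaussianReal s).mono' (Continuous.aestronglyMeasurable ?_)
    (ae_of_all _ fun z => ?_)
  · exact (by fun_prop : Continuous fun z => Real.cosh (s * z)).rpow_const
      fun z => Or.inl (Real.cosh_pos _).ne'
  · rw [Real.norm_eq_abs, abs_of_nonneg (Real.rpow_nonneg (Real.cosh_pos _).le _)]
    simpa using Real.rpow_le_rpow_of_exponent_le (Real.one_le_cosh (s * z)) hm1

theorem integral_cosh_rpow_le {s m : ℝ} (hm : 0 ≤ m) (hm1 : m ≤ 1) (hs : 9 * s ^ 2 ≤ 2) :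
    ∫ z, Real.cosh (s * z) ^ m ∂gaussianReal 0 1
      ≤ 1 + m * (s ^ 2 / 2 + (s ^ 2) ^ 2 / 8) - m * (1 - m) / 2 * (3 / 4 * (s ^ 2) ^ 2)
        + 26 * (s ^ 2) ^ 3 := by
  -- The cubic polynomial in `cosh` is rewritten in `cosh` of multiples of the argument, whose
  -- Gaussian integrals are explicit.
  have hpt : ∀ z, Real.cosh (s * z) ^ m ≤
      (1 - m - 3 * (m * (1 - m) / 4) - 5 / 2)
        + (m + m * (1 - m) + 15 / 4) * Real.cosh (s * z)
        + (-(m * (1 - m) / 4) - 3 / 2) * Real.cosh ((2 * s) * z)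
        + 1 / 4 * Real.cosh ((3 * s) * z) := by
    intro z
    have h1 := one_add_rpow_le_cubic hm hm1 (sub_nonneg.2 (Real.one_le_cosh (s * z)))
    rw [add_sub_cancel] at h1
    rw [mul_assoc 2, mul_assoc 3, Real.cosh_two_mul, Real.cosh_three_mul, Real.sinh_sq]
    nlinarith
  have i1 := (integrable_cosh_gaussianReal s).const_mul (m + m * (1 - m) + 15 / 4)
  have i2 := (integrable_cosh_gaussianReal (2 * s)).const_mul (-(m * (1 - m) / 4) - 3 / 2)
  have i3 := (integrable_cosh_gaussianReal (3 * s)).const_mul (1 / 4)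
  have i0 : Integrable (fun _ : ℝ => 1 - m - 3 * (m * (1 - m) / 4) - 5 / 2) (gaussianReal 0 1) :=
    integrable_const _
  have h := integral_mono (integrable_cosh_rpow_gaussianReal s hm1)
    (((i0.add i1).add i2).add i3) hpt
  refine h.trans ?_
  rw [integral_add' ((i0.add i1).add i2) i3, integral_add' (i0.add i1) i2,
    integral_add' i0 i1, integral_const, integral_const_mul, integral_const_mul,
    integral_const_mul, integral_cosh_gaussianReal, integral_cosh_gaussianReal,
    integral_cosh_gaussianReal]
  simp only [probReal_univ, smul_eq_mul, one_mul, mul_pow]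
  set v := s ^ 2 with hv
  have hv0 : 0 ≤ v := sq_nonneg s
  have bound : ∀ x : ℝ, 0 ≤ x → x ≤ 1 → |Real.exp x - (1 + x + x ^ 2 / 2)| ≤ 2 / 9 * x ^ 3 := by
    intro x hx hx1
    have := Real.exp_bound (x := x) (by rwa [abs_of_nonneg hx]) (n := 3) (by norm_num)
    simp [Finset.sum_range_succ, Nat.factorial, abs_of_nonneg hx] at this
    rw [mul_comm] at this
    norm_num at this
    convert this using 1
  have b1 := abs_le.1 (bound (v / 2) (by linarith) (by linarith))
  -- The hypothesis `9 * s ^ 2 ≤ 2` keeps all three exponents in `[0, 1]`; the largest is `9 v / 2`.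
  have b2 := abs_le.1 (bound (2 ^ 2 * v / 2) (by linarith) (by linarith))
  have b3 := abs_le.1 (bound (3 ^ 2 * v / 2) (by linarith) (by linarith))
  have hmm : 0 ≤ m * (1 - m) := mul_nonneg hm (sub_nonneg.2 hm1)
  have hmm1 : m * (1 - m) ≤ 1 := by nlinarith
  have c1 : 0 ≤ m + m * (1 - m) + 15 / 4 := by linarith
  have c2 : 0 ≤ m * (1 - m) / 4 + 3 / 2 := by linarith
  have d1 := mul_le_mul_of_nonneg_left b1.2 c1
  have d2 := mul_le_mul_of_nonneg_left b2.1 c2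
  have hv3 : 0 ≤ v ^ 3 := by positivity
  have f1 := mul_le_mul_of_nonneg_right hmm1 hv3
  have f2 := mul_le_mul_of_nonneg_right hm1 hv3
  nlinarith

/-- With `v = 2 c ^ 2 q`, the logarithm of the left side is `m v / 2 - m (1 - m) v ^ 2 / 4 + O(v ^
3)`, while the exponent on the right is `m v / 2 - m (1 - m) v ^ 2 / (8 c ^ 2)`. A small `q > 0`
works because `1 / (8 c ^ 2) < 1/4`, that is, `c ^ 2 > 1/2`. -/
theorem exists_integral_cosh_rpow_lt {c m : ℝ} (hm : 0 < m) (hm1 : m < 1) (hc : 1 / 2 < c ^ 2) :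
    ∃ q : ℝ, 0 ≤ q ∧ ∫ z, Real.cosh (c * √(2 * q) * z) ^ m ∂gaussianReal 0 1
      < Real.exp (m * (c ^ 2 * q - (1 - m) * c ^ 2 * q ^ 2 / 2)) := by
  set κ : ℝ := 1 / (8 * c ^ 2) with hκ
  have hc0 : 0 < c ^ 2 := by linarith
  have hκ0 : 0 < κ := by positivity
  have hκ1 : κ < 1 / 4 := by
    rw [hκ, div_lt_div_iff₀ (by positivity) (by norm_num)]; linarith
  have hm' : 0 < 1 - m := sub_pos.2 hm1
  set η := m * (1 - m) * (1 / 4 - κ) with hη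
  have hη0 : 0 < η := by
    have : 0 < 1 / 4 - κ := by linarith
    positivity
  -- The bound `2 / 9` is the range of the expansion; `η / 28` lets the second-order gap `η v ^ 2`
  -- absorb the cubic errors, `26` from the integral and at most `1/2` from the square of the
  -- exponent.
  set v := min (2 / 9) (η / 28) with hv
  have hv0 : 0 < v := lt_min (by norm_num) (by positivity)
  have hv1 : v ≤ 2 / 9 := min_le_left _ _
  have hv2 : 28 * v ≤ η := by
    have : v ≤ η / 28 := min_le_right _ _
    linarith
  refine ⟨v / (2 * c ^ 2), by positivity, ?_⟩
  have hs : (c * √(2 * (v / (2 * c ^ 2)))) ^ 2 = v := by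
    rw [mul_pow, Real.sq_sqrt (by positivity)]
    have : c ≠ 0 := by rintro rfl; simp at hc0
    field_simp
  refine (integral_cosh_rpow_le hm.le hm1.le (by rw [hs]; linarith)).trans_lt ?_
  rw [hs]
  have he : m * (c ^ 2 * (v / (2 * c ^ 2)) - (1 - m) * c ^ 2 * (v / (2 * c ^ 2)) ^ 2 / 2)
      = m * (v / 2 - κ * (1 - m) * v ^ 2) := by
    have : c ≠ 0 := by rintro rfl; simp at hc0
    rw [hκ]; field_simp; ring
  rw [he]
  have hk1 : κ * (1 - m) * v ≤ 1 / 2 := by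
    have : κ * (1 - m) ≤ 1 := by nlinarith
    nlinarith
  have hy : 0 ≤ m * (v / 2 - κ * (1 - m) * v ^ 2) := by
    refine mul_nonneg hm.le ?_
    nlinarith
  refine lt_of_lt_of_le ?_ (Real.quadratic_le_exp_of_nonneg hy)
  have h1 : 28 * v ^ 3 ≤ η * v ^ 2 := by nlinarith [sq_nonneg v]
  have hv3 : 0 < v ^ 3 := by positivity
  have h2 : m ^ 2 * (κ * (1 - m)) ≤ 1 := by
    have : κ * (1 - m) ≤ 1 := by nlinarith
    have h3 : m ^ 2 ≤ 1 := by nlinarith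
    have h4 : 0 ≤ κ * (1 - m) := by positivity
    nlinarith
  have h3 := mul_le_mul_of_nonneg_right h2 hv3.le
  have h4 : 0 ≤ m ^ 2 * (κ * (1 - m) * v ^ 2) ^ 2 := by positivity
  have h5 : (m * (v / 2 - κ * (1 - m) * v ^ 2)) ^ 2 / 2
      = m ^ 2 * v ^ 2 / 8 - m ^ 2 * (κ * (1 - m)) * v ^ 3 / 2
        + m ^ 2 * (κ * (1 - m) * v ^ 2) ^ 2 / 2 := by ring
  rw [h5]
  have h6 : η * v ^ 2 = m * (1 - m) / 4 * v ^ 2 - m * κ * (1 - m) * v ^ 2 := by rw [hη]; ring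
  nlinarith

end OneDimensional

/-! ### Replica symmetric bound in zero field -/

section ZeroField

variable {N : ℕ}

theorem measurePreserving_inl (ι κ : Type*) [Fintype ι] [Fintype κ] :
    MeasurePreserving (fun (x : ι ⊕ κ → ℝ) i => x (Sum.inl i)) (stdGaussian (ι ⊕ κ))
      (stdGaussian ι) :=
  measurePreserving_fst.comp
    (measurePreserving_sumPiEquivProdPi (fun _ : ι ⊕ κ => gaussianReal 0 1))

/-- The comparison system has independent Gaussian site fields, so its moment factorizes. It lives
on the sum of both index sets, as the interpolation needs the two systems on one Gaussian space. -/
theorem integral_expSum_rpow_spin (s m : ℝ) :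
    ∫ x, expSum (0 : Config N → ℝ)
        (fun σ => Sum.elim (fun _ : Fin N × Fin N => 0) fun i => s * spin σ i) x ^ m
        ∂stdGaussian (Fin N × Fin N ⊕ Fin N)
      = (2 ^ m * ∫ z, Real.cosh (s * z) ^ m ∂gaussianReal 0 1) ^ N := by
  have h1 : ∀ x : (Fin N × Fin N ⊕ Fin N) → ℝ, expSum (0 : Config N → ℝ)
        (fun σ => Sum.elim (fun _ : Fin N × Fin N => 0) fun i => s * spin σ i) x ^ m
      = ∏ k, (Sum.elim (fun (_ : Fin N × Fin N) (_ : ℝ) => (1 : ℝ))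
        (fun (_ : Fin N) (z : ℝ) => 2 ^ m * Real.cosh (s * z) ^ m) k) (x k) := by
    intro x
    rw [Fintype.prod_sum_type]
    simp only [Sum.elim_inl, Finset.prod_const_one, Sum.elim_inr, one_mul, expSum, Pi.zero_apply,
      zero_add, Fintype.sum_sum_type, zero_mul, Finset.sum_const_zero]
    have h2 : ∑ σ : Config N, Real.exp (∑ i, s * spin σ i * x (Sum.inr i))
        = ∏ i, (2 * Real.cosh (s * x (Sum.inr i))) := by
      rw [← sum_config_exp]
      refine Finset.sum_congr rfl fun σ _ => ?_
      congr 1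
      exact Finset.sum_congr rfl fun i _ => by ring
    rw [h2, ← Real.finsetProd_rpow _ _ fun i _ => by
      have := Real.cosh_pos (s * x (Sum.inr i)); positivity]
    exact Finset.prod_congr rfl fun i _ => Real.mul_rpow zero_le_two (Real.cosh_pos _).le
  simp_rw [h1]
  rw [integral_fintype_prod_eq_prod, Fintype.prod_sum_type]
  simp [integral_const_mul]

theorem integral_expSum_rpow_inl (c m : ℝ) :
    ∫ x, expSum (0 : Config N → ℝ)
        (fun σ => Sum.elim (fun p => -c * coef σ p) fun _ : Fin N => 0) x ^ m
        ∂stdGaussian (Fin N × Fin N ⊕ Fin N) = moment m c (0 : Config N → ℝ) := by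
  have hmp := measurePreserving_inl (Fin N × Fin N) (Fin N)
  rw [moment, ← hmp.map_eq, integral_map hmp.measurable.aemeasurable
    (continuous_expSum_rpow _ _ m).aestronglyMeasurable]
  refine integral_congr_ae (ae_of_all _ fun x => ?_)
  simp [expSum, Fintype.sum_sum_type]

/-- The replica symmetric interpolation bound for a fractional moment in zero field. -/
theorem moment_zero_le (hN : 0 < N) (c : ℝ) {m q : ℝ} (hm : 0 ≤ m) (hm1 : m ≤ 1) (hq : 0 ≤ q) :
    moment m c (0 : Config N → ℝ)
      ≤ Real.exp (m * N * (c ^ 2 * (1 - 2 * q) + (1 - m) * (c ^ 2 * q ^ 2)) / 2)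
        * (2 ^ m * ∫ z, Real.cosh (c * √(2 * q) * z) ^ m ∂gaussianReal 0 1) ^ N := by
  have hN' : (0 : ℝ) < N := by exact_mod_cast hN
  have hs2 : (c * √(2 * q)) ^ 2 = 2 * c ^ 2 * q := by
    rw [mul_pow, Real.sq_sqrt (by positivity)]; ring
  set s := c * √(2 * q) with hs
  have key := integral_expSum_rpow_comparison (0 : Config N → ℝ)
    (fun σ => Sum.elim (fun p => -c * coef σ p) fun _ : Fin N => 0)
    (fun σ => Sum.elim (fun _ : Fin N × Fin N => 0) fun i => s * spin σ i) hm hm1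
    -- The value of `E` is the minimum over real `R` of the covariance difference `c ^ 2 (R ^ 2 / N
    -- - 2 q R)`, attained at `R = N q`.
    (D := c ^ 2 * N - 2 * c ^ 2 * q * N) (E := -(N * (c ^ 2 * q ^ 2))) (fun σ τ => ?_) (fun σ => ?_)
    (fun σ τ => ?_)
  · rw [integral_expSum_rpow_inl, integral_expSum_rpow_spin] at key
    refine key.trans (le_of_eq ?_)
    congr 2
    ring
  · simp [Fintype.sum_sum_type]
  · simp only [Fintype.sum_sum_type, Sum.elim_inl, Sum.elim_inr, mul_pow, neg_sq, spin_sq,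
      ← Finset.mul_sum, sum_coef_sq, hs2]
    simp
  · simp only [Fintype.sum_sum_type, Sum.elim_inl, Sum.elim_inr, mul_zero,
      Finset.sum_const_zero, add_zero, zero_add]
    have e1 : ∑ p, -c * coef σ p * (-c * coef τ p)
        = c ^ 2 * ((∑ i, spin τ i * spin σ i) ^ 2 / N) := by
      rw [← sum_coef_mul_coef, Finset.mul_sum]
      exact Finset.sum_congr rfl fun p _ => by ring
    have e2 : ∑ i, s * spin σ i * (s * spin τ i)
        = 2 * c ^ 2 * q * ∑ i, spin τ i * spin σ i := by
      rw [← hs2, Finset.mul_sum]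
      exact Finset.sum_congr rfl fun p _ => by ring
    rw [e1, e2]
    set R := ∑ i, spin τ i * spin σ i
    have e3 : c ^ 2 * (R ^ 2 / N) - 2 * c ^ 2 * q * R - -(N * (c ^ 2 * q ^ 2))
        = c ^ 2 * (R - N * q) ^ 2 / N := by
      field_simp; ring
    have e4 : 0 ≤ c ^ 2 * (R - N * q) ^ 2 / N := by positivity
    linarith

/-- Below the critical temperature the fractional moments are exponentially smaller than the
annealed value. -/
theorem exists_log_moment_zero_le {c m : ℝ} (hm : 0 < m) (hm1 : m < 1) (hc : 1 / 2 < c ^ 2) :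
    ∃ δ : ℝ, 0 < δ ∧ ∀ N : ℕ, 0 < N → Real.log (moment m c (0 : Config N → ℝ))
      ≤ N * (m * (Real.log 2 + c ^ 2 / 2) - δ) := by
  obtain ⟨q, hq, hlt⟩ := exists_integral_cosh_rpow_lt hm hm1 hc
  set G := ∫ z, Real.cosh (c * √(2 * q) * z) ^ m ∂gaussianReal 0 1 with hG
  have hG1 : 1 ≤ G := by
    have : ∫ _ : ℝ, (1 : ℝ) ∂gaussianReal 0 1 ≤ G :=
      integral_mono (integrable_const _) (integrable_cosh_rpow_gaussianReal _ hm1.le)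
        fun z => Real.one_le_rpow (Real.one_le_cosh _) hm.le
    simpa using this
  have hlog := Real.log_lt_log (by linarith) hlt
  rw [Real.log_exp] at hlog
  refine ⟨m * (c ^ 2 * q - (1 - m) * c ^ 2 * q ^ 2 / 2) - Real.log G, sub_pos.2 hlog,
    fun N hN => ?_⟩
  have h := Real.log_le_log (moment_pos m c hm.le _) (moment_zero_le hN c hm.le hm1.le hq)
  have h2 : (0 : ℝ) < 2 ^ m := by positivity
  rw [← hG, Real.log_mul (Real.exp_pos _).ne' (by positivity), Real.log_exp, Real.log_pow,
    Real.log_mul h2.ne' (by positivity), Real.log_rpow two_pos] at h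
  refine h.trans (le_of_eq ?_)
  ring

end ZeroField

/-! ### Averages over the external field -/

section FieldAverage

/-- This is `1 - 1 / y ≤ log y` at `y = cosh x ^ 2`. It measures the gain from the field in the
quantity `tanh ^ 2` in which the second-moment loss is expressed. -/
theorem sq_tanh_le_two_mul_log_cosh (x : ℝ) : Real.tanh x ^ 2 ≤ 2 * Real.log (Real.cosh x) := by
  have hc := Real.cosh_pos x
  have h1 : Real.tanh x ^ 2 = 1 - (Real.cosh x ^ 2)⁻¹ := by
    rw [Real.tanh_eq_sinh_div_cosh, div_pow, Real.sinh_sq]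
    field_simp
  have h2 := Real.one_sub_inv_le_log_of_pos (pow_pos hc 2)
  rw [Real.log_pow] at h2
  rw [h1]
  exact_mod_cast h2

theorem sq_tanh_le_sq (x : ℝ) : Real.tanh x ^ 2 ≤ x ^ 2 := by
  have h1 := Real.log_le_log (Real.cosh_pos x) (Real.cosh_le_exp_half_sq x)
  rw [Real.log_exp] at h1
  linarith [sq_tanh_le_two_mul_log_cosh x]

theorem continuous_tanh : Continuous Real.tanh := by
  have : Real.tanh = fun x => Real.sinh x / Real.cosh x := funext Real.tanh_eq_sinh_div_cosh
  rw [this]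
  exact Real.continuous_sinh.div Real.continuous_cosh fun x => (Real.cosh_pos x).ne'

theorem continuous_log_cosh : Continuous fun x => Real.log (Real.cosh x) :=
  Real.continuous_cosh.log fun x => (Real.cosh_pos x).ne'

variable {Ph : Measure ℝ} [IsProbabilityMeasure Ph] {M : ℝ}

theorem ae_pi_of_ae {N : ℕ} {p : ℝ → Prop} (hp : ∀ᵐ x ∂Ph, p x) :
    ∀ᵐ h ∂Measure.pi (fun _ : Fin N => Ph), ∀ i, p (h i) :=
  ae_all_iff.2 fun i =>
    (measurePreserving_eval (fun _ : Fin N => Ph) i).quasiMeasurePreserving.ae hp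

/-- The fields almost surely lie in a fixed compact ball, where continuous functions are bounded. -/
theorem integrable_pi_of_continuous (hM : ∀ᵐ x ∂Ph, |x| ≤ M) {N : ℕ} {F : (Fin N → ℝ) → ℝ}
    (hF : Continuous F) : Integrable F (Measure.pi fun _ => Ph) := by
  obtain ⟨C, hC⟩ := (isCompact_closedBall (0 : Fin N → ℝ) |M|).exists_bound_of_continuousOn
    hF.continuousOn
  refine (integrable_const C).mono' hF.aestronglyMeasurable ?_
  filter_upwards [ae_pi_of_ae (N := N) hM] with h hh
  refine hC h ?_
  rw [mem_closedBall_zero_iff, pi_norm_le_iff_of_nonneg (abs_nonneg M)]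
  exact fun i => (hh i).trans (le_abs_self M)

theorem integrable_of_continuous_of_ae_abs_le (hM : ∀ᵐ x ∂Ph, |x| ≤ M) {φ : ℝ → ℝ}
    (hφ : Continuous φ) : Integrable φ Ph := by
  obtain ⟨C, hC⟩ := (isCompact_closedBall (0 : ℝ) M).exists_bound_of_continuousOn hφ.continuousOn
  refine (integrable_const C).mono' hφ.aestronglyMeasurable ?_
  filter_upwards [hM] with x hx
  exact hC x (by rwa [mem_closedBall_zero_iff])

theorem integral_pi_sum (hM : ∀ᵐ x ∂Ph, |x| ≤ M) (N : ℕ) {φ : ℝ → ℝ} (hφ : Continuous φ) :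
    ∫ h : Fin N → ℝ, ∑ i, φ (h i) ∂Measure.pi (fun _ => Ph) = N * ∫ x, φ x ∂Ph := by
  rw [integral_finsetSum _ fun i _ => integrable_pi_of_continuous hM (by fun_prop)]
  have : ∀ i : Fin N, ∫ h : Fin N → ℝ, φ (h i) ∂Measure.pi (fun _ => Ph) = ∫ x, φ x ∂Ph := by
    intro i
    have hmp := measurePreserving_eval (fun _ : Fin N => Ph) i
    have h1 := integral_map (μ := Measure.pi fun _ : Fin N => Ph) hmp.measurable.aemeasurable
      (f := φ) hφ.aestronglyMeasurable
    rw [hmp.map_eq] at h1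
    exact h1.symm
  simp [this]

theorem integral_sq_tanh_pos (hM : ∀ᵐ x ∂Ph, |x| ≤ M) (h0 : ¬ ∀ᵐ x ∂Ph, x = 0) {s : ℝ}
    (hs : 0 < s) : 0 < ∫ x, Real.tanh (s * x) ^ 2 ∂Ph := by
  have hcont : Continuous fun x => Real.tanh (s * x) ^ 2 :=
    (continuous_tanh.comp (by fun_prop)).pow 2
  refine lt_of_le_of_ne (integral_nonneg fun x => sq_nonneg _) fun h => h0 ?_
  have h1 := (integral_eq_zero_iff_of_nonneg (fun x => sq_nonneg _)
    (integrable_of_continuous_of_ae_abs_le hM hcont)).1 h.symm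
  filter_upwards [h1] with x hx
  have h2 : Real.tanh (s * x) = 0 := by simpa using hx
  rw [Real.tanh_eq_sinh_div_cosh, div_eq_zero_iff, or_iff_left (Real.cosh_pos _).ne',
    Real.sinh_eq_zero] at h2
  exact (mul_eq_zero.1 h2).resolve_left hs.ne'

end FieldAverage

/-! ### Bounds on the pressure and its limit -/

section Pressure

variable {Ph : Measure ℝ} [IsProbabilityMeasure Ph] {M : ℝ} {r : ℕ} {ζ γ : Fin (r + 1) → ℝ}
  {a b c : ℝ}

/-- The pressure of a system of size `N` in the fields `h`, before averaging and normalizing. -/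
noncomputable def logZ (ζ γ : Fin (r + 1) → ℝ) {N : ℕ} (h : Fin N → ℝ) : ℝ :=
  Real.log (multiscaleZ ζ γ h 0 (fun i => i.elim0))

theorem continuous_fieldWeight (N : ℕ) :
    Continuous (fieldWeight : (Fin N → ℝ) → Config N → ℝ) := by
  unfold fieldWeight; fun_prop

/-- The partition function lies between the fractional moments of a model with one scale. -/
structure HasMomentBounds (ζ γ : Fin (r + 1) → ℝ) (a b c : ℝ) : Prop where
  a_pos : 0 < a
  a_le : a ≤ 1
  b_pos : 0 < b
  b_lt : b < 1
  c_pos : 0 < c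
  continuous (N : ℕ) : Continuous fun h : Fin N → ℝ => logZ ζ γ h
  lower {N : ℕ} (h : Fin N → ℝ) : Real.log (moment a c (fieldWeight h)) ≤ a * logZ ζ γ h
  upper {N : ℕ} (h : Fin N → ℝ) : b * logZ ζ γ h ≤ Real.log (moment b c (fieldWeight h))

theorem exists_hasMomentBounds (hr : 1 ≤ r) (hζ : StrictMono ζ) (hζ0 : 0 < ζ 0)
    (hζr : ζ (Fin.last r) = 1) (hγ : StrictMono γ) (hγ0 : γ 0 = 0) :
    ∃ a b, HasMomentBounds ζ γ a b (γ (Fin.last r)) := by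
  obtain ⟨k, rfl⟩ : ∃ k, r = k + 1 := ⟨r - 1, by omega⟩
  -- The largest exponent used by the recursion is `ζ_{r-1}`, strictly below `ζ_r = 1`; the strict
  -- upper bounds rely on `b < 1`.
  set b := ζ (Fin.last k).castSucc with hb
  have hb1 : b < 1 := by rw [← hζr]; exact hζ (Fin.castSucc_lt_last _)
  have hab : ζ 0 ≤ b := hζ.monotone (Fin.zero_le _)
  have hγnn : ∀ i, 0 ≤ γ i := fun i => by rw [← hγ0]; exact hγ.monotone (Fin.zero_le i)
  have hc : 0 < γ (Fin.last (k + 1)) := by rw [← hγ0]; exact hγ (Fin.last_pos)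
  have hA : ∀ N : ℕ, ∃ A : (Config N → ℝ) → ℝ,
      IsBetweenMoments (ζ 0) b (γ (Fin.last (k + 1))) A ∧
      ∀ h : Fin N → ℝ, multiscaleZ ζ γ h 0 (fun i => i.elim0) = A (fieldWeight h) := by
    intro N
    obtain ⟨A, hA, hZ⟩ := exists_isBetweenMoments_multiscaleZ ζ γ N hζ0 hb1.le
      (fun i => hζ.monotone (Fin.zero_le _))
      (fun i => hζ.monotone (Fin.castSucc_le_castSucc_iff.2 (Fin.le_last i)))
      (fun i j hij => pow_le_pow_left₀ (hγnn i) (hγ.monotone hij) 2) 0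
    refine ⟨A, ?_, fun h => ?_⟩
    · rw [hγ0] at hA
      simpa [Real.sqrt_sq hc.le] using hA
    · rw [hZ]
      congr 1
      ext σ
      simp only [Pi.sub_apply, sub_eq_self]
      exact Finset.sum_of_isEmpty (ι := Fin 0) _
  refine ⟨ζ 0, b, hζ0, hab.trans hb1.le, hζ0.trans_le hab, hb1, hc, fun N => ?_, fun {N} h => ?_,
    fun {N} h => ?_⟩ <;> obtain ⟨A, hA, hZ⟩ := hA N
  · simp only [logZ, hZ]
    exact hA.continuous_log.comp (continuous_fieldWeight N)
  · rw [logZ, hZ, ← Real.log_rpow (hA.pos _)]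
    exact Real.log_le_log (moment_pos _ _ hζ0.le _) (hA.lower _)
  · rw [logZ, hZ, ← Real.log_rpow (hA.pos _)]
    exact Real.log_le_log (Real.rpow_pos_of_pos (hA.pos _) _) (hA.upper _)

theorem pressure_eq (ζ γ : Fin (r + 1) → ℝ) (Ph : Measure ℝ) (N : ℕ) :
    pressure ζ γ Ph N
      = 1 / (N : ℝ) * ∫ h : Fin N → ℝ, logZ ζ γ h ∂Measure.pi (fun _ => Ph) := rfl

theorem le_pressure (hM : ∀ᵐ x ∂Ph, |x| ≤ M) {N : ℕ} (hN : 0 < N)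
    (hcont : Continuous fun h : Fin N → ℝ => logZ ζ γ h) {φ : ℝ → ℝ} (hφ : Continuous φ) (K e : ℝ)
    (hle : ∀ᵐ h ∂Measure.pi (fun _ : Fin N => Ph), N * K + ∑ i, φ (h i) - e ≤ logZ ζ γ h) :
    K + ∫ x, φ x ∂Ph - e / N ≤ pressure ζ γ Ph N := by
  have hN' : (0 : ℝ) < N := by exact_mod_cast hN
  have hi := integrable_pi_of_continuous hM hcont
  have hs : Integrable (fun h : Fin N → ℝ => ∑ i, φ (h i)) (Measure.pi fun _ => Ph) :=
    integrable_pi_of_continuous hM (by fun_prop)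
  have h1 := integral_mono_ae (((integrable_const (N * K)).add hs).sub (integrable_const e)) hi hle
  rw [integral_sub' ((integrable_const (N * K)).add hs) (integrable_const e),
    integral_add' (integrable_const (N * K)) hs, integral_pi_sum hM N hφ] at h1
  simp only [integral_const, probReal_univ, smul_eq_mul, one_mul] at h1
  rw [pressure_eq, one_div_mul_eq_div, le_div_iff₀ hN']
  refine le_trans (le_of_eq ?_) h1
  field_simp

theorem pressure_le (hM : ∀ᵐ x ∂Ph, |x| ≤ M) {N : ℕ} (hN : 0 < N)
    (hcont : Continuous fun h : Fin N → ℝ => logZ ζ γ h) {φ : ℝ → ℝ} (hφ : Continuous φ) (K : ℝ)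
    (hle : ∀ᵐ h ∂Measure.pi (fun _ : Fin N => Ph), logZ ζ γ h ≤ N * K + ∑ i, φ (h i)) :
    pressure ζ γ Ph N ≤ K + ∫ x, φ x ∂Ph := by
  have hN' : (0 : ℝ) < N := by exact_mod_cast hN
  have hi := integrable_pi_of_continuous hM hcont
  have hs : Integrable (fun h : Fin N → ℝ => ∑ i, φ (h i)) (Measure.pi fun _ => Ph) :=
    integrable_pi_of_continuous hM (by fun_prop)
  have h1 := integral_mono_ae hi ((integrable_const (N * K)).add hs) hle
  rw [integral_add' (integrable_const (N * K)) hs, integral_pi_sum hM N hφ] at h1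
  simp only [integral_const, probReal_univ, smul_eq_mul, one_mul] at h1
  rw [pressure_eq, one_div_mul_eq_div, div_le_iff₀ hN']
  refine h1.trans (le_of_eq ?_)
  ring

/-- At high temperature the pressure is at least the annealed pressure without field, with a gain
if there is a field. -/
theorem HasMomentBounds.exists_le_pressure (hB : HasMomentBounds ζ γ a b c)
    (hM : ∀ᵐ x ∂Ph, |x| ≤ M) (hc : c ^ 2 ≤ 1 / 2) :
    ∃ s : ℝ, 0 < s ∧ ∀ N : ℕ, 0 < N → Real.log 2 + c ^ 2 / 2
      + (∫ x, 1 / 4 * Real.tanh (s * x) ^ 2 ∂Ph) - Real.log (4 * (2 * N + 1)) / a / N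
      ≤ pressure ζ γ Ph N := by
  have ha := hB.a_pos
  set κ : ℝ := (a / 8) ^ 3 / 48 with hκ
  have hκ0 : 0 < κ := by positivity
  -- The field is scaled by `s` so that `2 * tanh (s x) ^ 2 ≤ 2 * s * M ^ 2 ≤ κ`, as the
  -- second-moment estimate demands.
  set s : ℝ := min 1 (κ / (2 * M ^ 2 + 1)) with hs
  have hs0 : 0 < s := lt_min one_pos (by positivity)
  have hs1 : s ≤ 1 := min_le_left _ _
  have hs2 : s * (2 * M ^ 2 + 1) ≤ κ := by
    rw [← le_div_iff₀ (by positivity)]; exact min_le_right _ _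
  have hcont : Continuous fun x => 1 / 4 * Real.tanh (s * x) ^ 2 :=
    continuous_const.mul ((continuous_tanh.comp (by fun_prop)).pow 2)
  refine ⟨s, hs0, fun N hN => le_pressure hM hN (hB.continuous N) hcont _ _ ?_⟩
  filter_upwards [ae_pi_of_ae (N := N) hM] with h hh
  have hQ : 2 * ∑ i, Real.tanh ((s • h) i) ^ 2 ≤ N * ((a / 8) ^ 3 / 48) := by
    rw [Finset.mul_sum]
    refine (Finset.sum_le_card_nsmul _ _ κ fun i _ => ?_).trans (by simp [hκ])
    have h1 := sq_tanh_le_sq ((s • h) i)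
    have h2 : h i ^ 2 ≤ M ^ 2 := sq_le_sq' (abs_le.1 (hh i)).1 (abs_le.1 (hh i)).2
    simp only [Pi.smul_apply, smul_eq_mul, mul_pow] at h1 ⊢
    have h3 : s ^ 2 ≤ s := by nlinarith
    have h4 : s ^ 2 * h i ^ 2 ≤ s * M ^ 2 := mul_le_mul h3 h2 (sq_nonneg _) hs0.le
    nlinarith
  -- With `ε = a / 8` the loss is `a / 4` times `∑ tanh ^ 2`, while `log cosh` gains at least `a /
  -- 2` times it; division by `a` leaves the `1/4` of the statement.
  have h1 := le_log_moment hN hc (s • h) ha.le hB.a_le (ε := a / 8) (by positivity) hQ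
  have h2 := Real.log_le_log (moment_pos a c ha.le _)
    (moment_fieldWeight_smul_le ha.le c h hs0.le hs1)
  have h3 := hB.lower h
  simp only [Pi.smul_apply, smul_eq_mul] at h1
  have h4 : ∑ i, Real.tanh (s * h i) ^ 2 ≤ 2 * ∑ i, Real.log (Real.cosh (s * h i)) := by
    rw [Finset.mul_sum]
    exact Finset.sum_le_sum fun i _ => sq_tanh_le_two_mul_log_cosh _
  rw [← Finset.mul_sum]
  have h5 := h1.trans (h2.trans h3)
  rw [← mul_le_mul_iff_right₀ ha]
  have h6 : a * (Real.log (4 * (2 * N + 1)) / a) = Real.log (4 * (2 * N + 1)) := by field_simp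
  rw [mul_sub, h6]
  have h7 := mul_le_mul_of_nonneg_left h4 ha.le
  nlinarith

/-- The pressure is at most the annealed one. -/
theorem HasMomentBounds.pressure_le_annealed (hB : HasMomentBounds ζ γ a b c)
    (hM : ∀ᵐ x ∂Ph, |x| ≤ M) {N : ℕ} (hN : 0 < N) :
    pressure ζ γ Ph N ≤ Real.log 2 + c ^ 2 / 2 + ∫ x, Real.log (Real.cosh x) ∂Ph := by
  refine pressure_le hM hN (hB.continuous N) continuous_log_cosh _ (ae_of_all _ fun h => ?_)
  -- With `a = l = 0` there is no tilt, and the bound is plain Jensen.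
  have h1 := (hB.upper h).trans (log_moment_le hN hB.b_pos hB.b_lt hB.c_pos.le le_rfl zero_le_one
    le_rfl (by simp) h)
  rw [mul_le_mul_iff_right₀ hB.b_pos] at h1
  simpa using h1

/-- In a field, the pressure is strictly smaller than the annealed one, uniformly in the size. -/
theorem HasMomentBounds.exists_pressure_le_of_field (hB : HasMomentBounds ζ γ a b c)
    (hM : ∀ᵐ x ∂Ph, |x| ≤ M) (h0 : ¬ ∀ᵐ x ∂Ph, x = 0) :
    ∃ δ : ℝ, 0 < δ ∧ ∀ N : ℕ, 0 < N → pressure ζ γ Ph N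
      ≤ Real.log 2 + (∫ x, Real.log (Real.cosh x) ∂Ph) + c ^ 2 / 2 - δ := by
  have hc := hB.c_pos
  have hb' : 0 < 1 - b := sub_pos.2 hB.b_lt
  set t : ℝ := ∫ x, Real.tanh x ^ 2 ∂Ph with ht
  have hct : Continuous fun x => Real.tanh x ^ 2 := continuous_tanh.pow 2
  have ht0 : 0 < t := by simpa using integral_sq_tanh_pos hM h0 one_pos
  have ht1 : t ≤ 1 := by
    have := integral_mono (integrable_of_continuous_of_ae_abs_le hM hct) (integrable_const (1 : ℝ))
      fun x => sq_tanh_le_one x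
    simpa using this
  set D : ℝ := 1 / (2 * (1 - b)) + 4 * c ^ 2 with hD
  have hD0 : 0 < D := by positivity
  have hcD : 4 * c ^ 2 ≤ D := by
    have : 0 < 1 / (2 * (1 - b)) := by positivity
    linarith
  -- With `a = t`, the mean of `tanh ^ 2`, the averaged correction is `-c l t ^ 2 + D l ^ 2`. This
  -- `l` minimizes it, with value `-c ^ 2 t ^ 4 / (4 D)`.
  set l : ℝ := c * t ^ 2 / (2 * D) with hl
  have hl0 : 0 ≤ l := by positivity
  have hcl : 2 * c * l ≤ 1 := by
    rw [hl, ← mul_div_assoc, div_le_one (by positivity)]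
    have : t ^ 2 ≤ 1 := pow_le_one₀ ht0.le ht1
    nlinarith [sq_nonneg c]
  refine ⟨c ^ 2 * t ^ 4 / (4 * D), by positivity, fun N hN => ?_⟩
  have hφ : Continuous fun x => Real.log (Real.cosh x) - 2 * t * c * l * Real.tanh x ^ 2 :=
    continuous_log_cosh.sub (continuous_const.mul hct)
  refine (pressure_le hM hN (hB.continuous N) hφ
    (Real.log 2 + c ^ 2 / 2 + (c * l * t ^ 2 + l ^ 2 * D)) (ae_of_all _ fun h => ?_)).trans
    (le_of_eq ?_)
  · have h1 := (hB.upper h).trans (log_moment_le hN hB.b_pos hB.b_lt hc.le ht0.le ht1 hl0 hcl h)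
    rw [mul_le_mul_iff_right₀ hB.b_pos] at h1
    refine h1.trans (le_of_eq ?_)
    rw [Finset.sum_sub_distrib, ← Finset.mul_sum]
    ring
  · rw [integral_sub (integrable_of_continuous_of_ae_abs_le hM continuous_log_cosh)
      ((integrable_of_continuous_of_ae_abs_le hM hct).const_mul _), integral_const_mul, ← ht, hl]
    field_simp
    ring

/-- Without field, the pressure is strictly smaller than the annealed one at low temperature. -/
theorem HasMomentBounds.exists_pressure_le_of_zero_field (hB : HasMomentBounds ζ γ a b c)
    (hM : ∀ᵐ x ∂Ph, |x| ≤ M) (h0 : ∀ᵐ x ∂Ph, x = 0) (hc : 1 / 2 < c ^ 2) :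
    ∃ δ : ℝ, 0 < δ ∧ ∀ N : ℕ, 0 < N → pressure ζ γ Ph N ≤ Real.log 2 + c ^ 2 / 2 - δ := by
  obtain ⟨δ, hδ, hle⟩ := exists_log_moment_zero_le hB.b_pos hB.b_lt hc
  refine ⟨δ / b, div_pos hδ hB.b_pos, fun N hN => ?_⟩
  have key := pressure_le (Ph := Ph) (φ := fun _ => 0) hM hN (hB.continuous N) continuous_const
    (Real.log 2 + c ^ 2 / 2 - δ / b) ?_
  · simpa using key
  filter_upwards [ae_pi_of_ae (N := N) h0] with h hh
  have h1 : fieldWeight h = 0 := by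
    ext σ
    simp [fieldWeight, hh]
  have h2 := hB.upper h
  rw [h1] at h2
  rw [← mul_le_mul_iff_right₀ hB.b_pos]
  refine (h2.trans (hle N hN)).trans (le_of_eq ?_)
  have := hB.b_pos.ne'
  simp only [Finset.sum_const_zero, add_zero]
  field_simp

theorem tendsto_log_div_div (a : ℝ) :
    Tendsto (fun N : ℕ => Real.log (4 * (2 * N + 1)) / a / N) atTop (𝓝 0) := by
  have h1 := Real.tendsto_pow_log_div_mul_add_atTop (1 / 8) (-1 / 2) 1 (by norm_num)
  have h2 : Tendsto (fun N : ℕ => (4 : ℝ) * (2 * N + 1)) atTop atTop :=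
    (tendsto_atTop_add_const_right _ _
      (tendsto_natCast_atTop_atTop.const_mul_atTop two_pos)).const_mul_atTop (by norm_num)
  have h3 := (h1.comp h2).div_const a
  rw [zero_div] at h3
  refine h3.congr fun N => ?_
  simp only [Function.comp_apply, pow_one]
  rw [div_right_comm]
  congr 1
  ring_nf

theorem not_tendsto_of_le_sub {u : ℕ → ℝ} {L δ : ℝ} (hδ : 0 < δ)
    (hu : ∀ N : ℕ, 0 < N → u N ≤ L - δ) : ¬ Tendsto u atTop (𝓝 L) := fun h => by
  have := le_of_tendsto h ((eventually_gt_atTop 0).mono hu)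
  linarith

theorem HasMomentBounds.tendsto_pressure (hB : HasMomentBounds ζ γ a b c)
    (hM : ∀ᵐ x ∂Ph, |x| ≤ M) (h0 : ∀ᵐ x ∂Ph, x = 0) (hc : c ^ 2 ≤ 1 / 2) :
    Tendsto (fun N => pressure ζ γ Ph N) atTop (𝓝 (Real.log 2 + c ^ 2 / 2)) := by
  obtain ⟨s, -, hle⟩ := hB.exists_le_pressure hM hc
  have hint : ∫ x, Real.log (Real.cosh x) ∂Ph = 0 :=
    integral_eq_zero_of_ae (h0.mono fun x hx => by simp [hx])
  have hlow : Tendsto (fun N : ℕ => Real.log 2 + c ^ 2 / 2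
      - Real.log (4 * (2 * N + 1)) / a / N) atTop (𝓝 (Real.log 2 + c ^ 2 / 2)) := by
    simpa using (tendsto_log_div_div a).const_sub (Real.log 2 + c ^ 2 / 2)
  refine tendsto_of_tendsto_of_tendsto_of_le_of_le' hlow tendsto_const_nhds ?_ ?_
  · filter_upwards [eventually_gt_atTop 0] with N hN
    have h1 : 0 ≤ ∫ x, 1 / 4 * Real.tanh (s * x) ^ 2 ∂Ph := integral_nonneg fun x => by positivity
    linarith [hle N hN]
  · filter_upwards [eventually_gt_atTop 0] with N hN
    simpa [hint] using hB.pressure_le_annealed hM hN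

/-- The lower bound exceeds the field-free annealed value by a fixed positive integral, and the
error in it vanishes as `N` grows. -/
theorem HasMomentBounds.not_tendsto_of_field (hB : HasMomentBounds ζ γ a b c)
    (hM : ∀ᵐ x ∂Ph, |x| ≤ M) (h0 : ¬ ∀ᵐ x ∂Ph, x = 0) (hc : c ^ 2 ≤ 1 / 2) :
    ¬ Tendsto (fun N => pressure ζ γ Ph N) atTop (𝓝 (Real.log 2 + c ^ 2 / 2)) := by
  obtain ⟨s, hs, hle⟩ := hB.exists_le_pressure hM hc
  intro h
  have hpos : 0 < ∫ x, 1 / 4 * Real.tanh (s * x) ^ 2 ∂Ph := by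
    rw [integral_const_mul]
    exact mul_pos (by norm_num) (integral_sq_tanh_pos hM h0 hs)
  have h1 := le_of_tendsto_of_tendsto ((tendsto_log_div_div a).const_sub (Real.log 2 + c ^ 2 / 2
    + ∫ x, 1 / 4 * Real.tanh (s * x) ^ 2 ∂Ph)) h ((eventually_gt_atTop 0).mono hle)
  linarith

end Pressure

end MultiscaleSK

/-- The restriction in the first part excludes a nonzero field with `γ_r ^ 2 > 1/2`, where the gain
from the field and the low-temperature loss compete. The second part needs no restriction: a nonzero
field alone puts the pressure strictly below the annealed value at every temperature. -/
theorem theorem4 (r : ℕ) (hr : 1 ≤ r) (ζ γ : Fin (r + 1) → ℝ)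
    (hζ : StrictMono ζ) (hζ0 : 0 < ζ 0) (hζr : ζ (Fin.last r) = 1)
    (hγ : StrictMono γ) (hγ0 : γ 0 = 0)
    (Ph : Measure ℝ) [IsProbabilityMeasure Ph]
    (hPh : ∃ K : Set ℝ, IsCompact K ∧ Ph Kᶜ = 0) :
    (((∀ᵐ x ∂Ph, x = 0) ∨ γ (Fin.last r) ^ 2 ≤ 1 / 2) →
      (Tendsto (fun N : ℕ => MultiscaleSK.pressure ζ γ Ph N) atTop
          (𝓝 (Real.log 2 + γ (Fin.last r) ^ 2 / 2)) ↔
        γ (Fin.last r) ^ 2 ≤ 1 / 2 ∧ ∀ᵐ x ∂Ph, x = 0)) ∧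
    (Tendsto (fun N : ℕ => MultiscaleSK.pressure ζ γ Ph N) atTop
        (𝓝 (Real.log 2 + (∫ x, Real.log (Real.cosh x) ∂Ph) + γ (Fin.last r) ^ 2 / 2)) ↔
      γ (Fin.last r) ^ 2 ≤ 1 / 2 ∧ ∀ᵐ x ∂Ph, x = 0) := by
  obtain ⟨a, b, hB⟩ := MultiscaleSK.exists_hasMomentBounds hr hζ hζ0 hζr hγ hγ0
  obtain ⟨M, hM⟩ : ∃ M : ℝ, ∀ᵐ x ∂Ph, |x| ≤ M := by
    obtain ⟨K, hK, hK0⟩ := hPh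
    obtain ⟨M, hM⟩ := hK.isBounded.exists_norm_le
    refine ⟨M, ?_⟩
    have h1 : ∀ᵐ x ∂Ph, x ∈ K := mem_ae_iff.2 hK0
    exact h1.mono fun x hx => hM x hx
  have hlow : (∀ᵐ x ∂Ph, x = 0) →
      Tendsto (fun N : ℕ => MultiscaleSK.pressure ζ γ Ph N) atTop
        (𝓝 (Real.log 2 + γ (Fin.last r) ^ 2 / 2)) → γ (Fin.last r) ^ 2 ≤ 1 / 2 := by
    intro h0 ht
    by_contra hc
    obtain ⟨δ, hδ, hle⟩ := hB.exists_pressure_le_of_zero_field hM h0 (not_le.1 hc)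
    exact MultiscaleSK.not_tendsto_of_le_sub hδ hle ht
  have hint : (∀ᵐ x ∂Ph, x = 0) → ∫ x, Real.log (Real.cosh x) ∂Ph = 0 := fun h0 =>
    integral_eq_zero_of_ae (h0.mono fun x hx => by simp [hx])
  refine ⟨fun hor => ⟨fun ht => ?_, fun h => hB.tendsto_pressure hM h.2 h.1⟩,
    ⟨fun ht => ?_, fun h => ?_⟩⟩
  · rcases hor with h0 | hc
    · exact ⟨hlow h0 ht, h0⟩
    · exact ⟨hc, by_contra fun h0 => hB.not_tendsto_of_field hM h0 hc ht⟩
  · have h0 : ∀ᵐ x ∂Ph, x = 0 := by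
      by_contra h0
      obtain ⟨δ, hδ, hle⟩ := hB.exists_pressure_le_of_field hM h0
      exact MultiscaleSK.not_tendsto_of_le_sub hδ hle ht
    rw [hint h0, add_zero] at ht
    exact ⟨hlow h0 ht, h0⟩
  · rw [hint h.2, add_zero]
    exact hB.tendsto_pressure hM h.2 h.1
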